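/- Let $\mathbb K=\mathbb R$ or $\mathbb C$, let $1\le k\le n$ be integers, and let $X_1,\dots,X_n,Y$ be Banach spaces over $\mathbb K$. Notation. For $0<q<\infty$, $\ell_q^w(X)$ is the set of sequences $(x_i)_{i\ge1}$ in $X$ with $\sup_{\|\varphi\|_{X^*}\le1}\sum_i|\varphi(x_i)|^q<\infty$, and $\ell_\infty^w(X)=\ell_\infty(X)$ is the set of bounded sequences. For $0<p,q_1,\dots,q_n\le\infty$ with $\frac1p\le\frac1{q_1}+\dots+\frac1{q_n}$ (where $1/\infty=0$), $\Pi^n_{p;q_1,\dots,q_n}(X_1,\dots,X_n;Y)$ is the set of continuous $n$-linear operators $T:X_1\times\dots\times X_n\to Y$ such that $(T(x_i^{(1)},\dots,x_i^{(n)}))_{i}\in\ell_p(Y)$ whenever $(x_i^{(j)})_i\in\ell_{q_j}^w(X_j)$ for $j=1,\dots,n$. A Banach space $X$ has cotype $s\in[2,\infty)$ if there is a constant $C$ such that $\big(\sum_{i=1}^m\|x_i\|^s\big)^{1/s}\le C\big(2^{-m}\sum_{\varepsilon\in\{-1,1\}^m}\|\sum_{i=1}^m\varepsilon_ix_i\|^2\big)^{1/2}$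 for all $m$ and $x_1,\dots,x_m\in X$. For $1<s<\infty$, $s^*=s/(s-1)$. Theorem. Let $s\ge1$ be real, and suppose that $X_j$ has finite cotype $s_j\ge2$ for $j=1,\dots,k$, with $$\frac1s\le\frac1{s_1}+\dots+\frac1{s_k}.$$ Let $q\in[1,\infty]$ and $\theta\in(0,1)$, let $p_1,\dots,p_k$ be real numbers with $1\le p_j\le2$ when $s_j=2$ and $1\le p_j<s_j^*$ when $s_j>2$, and let $0<p\le\infty$ satisfy $\frac1p\le\frac1{p_1}+\dots+\frac1{p_k}+\frac{n-k}q$. Define $r,r_1,\dots,r_k$ by $$\frac1r=\frac{1-\theta}s+\frac\theta p,\qquad \frac1{r_j}=(1-\theta)+\frac\theta{p_j}\quad(j=1,\dots,k).$$ Then $\frac1r\le\frac1{r_1}+\dots+\frac1{r_k}+\frac{n-k}q$ and $$\Pi^n_{p;p_1,\dots,p_k,q,\dots,q}(X_1,\dots,X_n;Y)\subseteq\Pi^n_{r;r_1,\dots,r_k,q,\dots,q}(X_1,\dots,X_n;Y).$$ -/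

import Mathlib

open scoped ENNReal

/-- The normed space `X` has (Rademacher) cotype `s`: for some constant `C`, every finite family
`x₁, …, xₘ` satisfies `(∑ ‖xᵢ‖ ^ s) ^ (1/s) ≤ C (𝔼 ‖∑ εᵢ xᵢ‖ ²) ^ (1/2)`, where the expectation
is the average over all `2 ^ m` choices of signs `ε`. -/
def HasCotype (s : ℝ) (X : Type*) [NormedAddCommGroup X] : Prop :=
  ∃ C : ℝ, ∀ (m : ℕ) (x : Fin m → X),
    (∑ i, ‖x i‖ ^ s) ^ (1 / s) ≤
      C * Real.sqrt ((∑ ε : Fin m → ℤˣ, ‖∑ i, ((ε i : ℤˣ) : ℤ) • x i‖ ^ 2) / 2 ^ m)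

/-- The sequence `x` belongs to `ℓ_q^w(X)`: the supremum over the closed unit ball of the dual of
`∑ᵢ |φ(xᵢ)| ^ q` (of `supᵢ |φ(xᵢ)|` when `q = ∞`) is finite. -/
def WeaklySummable (𝕜 : Type*) [RCLike 𝕜] {X : Type*} [NormedAddCommGroup X] [NormedSpace 𝕜 X]
    (q : ℝ≥0∞) (x : ℕ → X) : Prop :=
  if q = ∞ then
    (⨆ φ ∈ Metric.closedBall (0 : X →L[𝕜] 𝕜) 1, ⨆ i, ‖φ (x i)‖ₑ) < ∞
  else
    (⨆ φ ∈ Metric.closedBall (0 : X →L[𝕜] 𝕜) 1, ∑' i, ‖φ (x i)‖ₑ ^ q.toReal) < ∞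

/-- The class `Π^n_{p; q₁, …, qₙ}(X₁, …, Xₙ; Y)` of absolutely `(p; q₁, …, qₙ)`-summing continuous
`n`-linear operators. As usual the exponents are subject to `1/p ≤ 1/q₁ + ⋯ + 1/qₙ`. -/
def AbsSumming (𝕜 : Type*) [RCLike 𝕜] {n : ℕ} (X : Fin n → Type*) (Y : Type*)
    [∀ j, NormedAddCommGroup (X j)] [∀ j, NormedSpace 𝕜 (X j)]
    [NormedAddCommGroup Y] [NormedSpace 𝕜 Y] (p : ℝ≥0∞) (q : Fin n → ℝ≥0∞) :
    Set (ContinuousMultilinearMap 𝕜 X Y) :=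
  {T | p⁻¹ ≤ ∑ j, (q j)⁻¹ ∧
    ∀ x : (j : Fin n) → ℕ → X j, (∀ j, WeaklySummable 𝕜 (q j) (x j)) →
      Memℓp (fun i : ℕ => T (fun j => x j i)) p}

/-- The `n`-tuple of exponents `(a₁, …, a_k, q, …, q)`. -/
noncomputable def mixedExponents (n : ℕ) {k : ℕ} (a : Fin k → ℝ) (q : ℝ≥0∞) : Fin n → ℝ≥0∞ :=
  fun j => if h : (j : ℕ) < k then ENNReal.ofReal (a ⟨j, h⟩) else q

/-! Everything rests on one factorization, `WeaklySummable.exists_factorization`. In a space of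
cotype `σ`, a weakly `b`-summable sequence, `1/b = (1-θ) + θ/a`, can be written `x i = λ i ^ (1-θ) •
w i`, where `w` is weakly `a`-summable and `λ i * ‖w i‖` is in `ℓ_σ`. Factor the first `k`
coordinates in this way and take `λ = 1` in the others. By multilinearity, with `Λ` the product of
all the `λ`'s, `‖T x‖ = Λ^(1-θ) ‖T w‖ = (Λ ‖T w‖)^(1-θ) ‖T w‖^θ`. The base `Λ ‖T w‖` is at most a
constant times the product of the `k` sequences `λ ‖w‖`, hence in `ℓ_s` by Hölder; `T w` is in `ℓ_p`
by hypothesis; Hölder again puts `T x` in `ℓ_r`.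

The factorization is a Maurey-type theorem. Let `q` be conjugate to `a` and `ρ = q/θ`, which is
conjugate to `b`. The sequence `x` is a bounded operator on `ℓ_ρ` (unit vectors to `x i`). Cotype
makes it `(σ, 1)`-concave, and `2`-concave when `σ = 2`, the latter through Khintchine. Concavity
yields a weight `β` with `∑ β^ρ ≤ 1` and `‖∑ c i • x i‖^q ≤ K ∑ β^(ρ-q) |c|^q`; then `λ = β^(1/θ)`
works. The weight comes from a family of vectors that nearly attains the best concavity constant:
perturbing the family cannot raise its value by more than the constant allows, and this is already
an estimate with a density. For `σ < q` it is a restricted estimate, upgraded by dyadic summation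
(`exists_weight_of_one_concave`); the endpoint `σ = a = 2` is reached by differentiation
(`exists_weight_of_two_concave`). -/

/-- The value `∑ₖ ‖∑_{i ∈ F} aₖ(i) xᵢ‖ ^ s` of a finite family of coefficient vectors. -/
noncomputable def familyValue {𝕜 ι X : Type*} [RCLike 𝕜] [NormedAddCommGroup X] [NormedSpace 𝕜 X]
    (F : Finset ι) (x : ι → X) (s : ℝ) {m : ℕ} (a : Fin m → ι → 𝕜) : ℝ :=
  ∑ k, ‖∑ i ∈ F, a k i • x i‖ ^ s

/-- The gauge `∑_{i ∈ F} (∑ₖ |aₖ(i)| ^ e) ^ (ρ / e)` of a finite family of coefficient vectors. -/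
noncomputable def familyGauge {𝕜 ι : Type*} [RCLike 𝕜]
    (F : Finset ι) (e ρ : ℝ) {m : ℕ} (a : Fin m → ι → 𝕜) : ℝ :=
  ∑ i ∈ F, (∑ k, ‖a k i‖ ^ e) ^ (ρ / e)

/-! ### Near-extremal families for concavity inequalities, and their densities. -/

section Families

variable {𝕜 ι X : Type*} [RCLike 𝕜] [NormedAddCommGroup X] [NormedSpace 𝕜 X]

lemma familyGauge_nonneg (F : Finset ι) (e ρ : ℝ) {m : ℕ} (a : Fin m → ι → 𝕜) :
    0 ≤ familyGauge F e ρ a :=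
  Finset.sum_nonneg fun _ _ => Real.rpow_nonneg
    (Finset.sum_nonneg fun _ _ => Real.rpow_nonneg (norm_nonneg _) _) _

lemma familyValue_smul (F : Finset ι) (x : ι → X) (s : ℝ) {m : ℕ} (a : Fin m → ι → 𝕜)
    {t : ℝ} (ht : 0 ≤ t) :
    familyValue F x s (fun k i => (t : 𝕜) * a k i) = t ^ s * familyValue F x s a := by
  simp only [familyValue, Finset.mul_sum]
  refine Finset.sum_congr rfl fun k _ => ?_
  simp only [mul_smul, ← Finset.smul_sum]
  rw [norm_smul, RCLike.norm_ofReal, abs_of_nonneg ht, Real.mul_rpow ht (norm_nonneg _)]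

lemma familyGauge_smul (F : Finset ι) {e : ℝ} (he : 0 < e) (ρ : ℝ) {m : ℕ} (a : Fin m → ι → 𝕜)
    {t : ℝ} (ht : 0 ≤ t) :
    familyGauge F e ρ (fun k i => (t : 𝕜) * a k i) = t ^ ρ * familyGauge F e ρ a := by
  simp only [familyGauge, Finset.mul_sum]
  refine Finset.sum_congr rfl fun i _ => ?_
  simp only [norm_mul, RCLike.norm_ofReal, abs_of_nonneg ht]
  simp only [Real.mul_rpow ht (norm_nonneg _), ← Finset.mul_sum]
  rw [Real.mul_rpow (Real.rpow_nonneg ht _)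
    (Finset.sum_nonneg fun _ _ => Real.rpow_nonneg (norm_nonneg _) _), ← Real.rpow_mul ht]
  congr 2
  field_simp

/-- The best constant in the inequality `value ≤ S * gauge ^ (s / ρ)` is attained approximately
by families of gauge at most one. -/
lemma exists_best_constant (F : Finset ι) (x : ι → X) {s e ρ S₀ : ℝ} (hs : 0 < s) (he : 0 < e)
    (hρ : 0 < ρ) (hS₀ : 0 ≤ S₀)
    (H : ∀ (m : ℕ) (a : Fin m → ι → 𝕜),
      familyValue F x s a ≤ S₀ * familyGauge F e ρ a ^ (s / ρ)) :
    ∃ S, 0 ≤ S ∧ S ≤ S₀ ∧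
      (∀ (m : ℕ) (a : Fin m → ι → 𝕜),
        familyValue F x s a ≤ S * familyGauge F e ρ a ^ (s / ρ)) ∧
      ∀ δ > 0, ∃ (m : ℕ) (a : Fin m → ι → 𝕜),
        familyGauge F e ρ a ≤ 1 ∧ S - δ ≤ familyValue F x s a := by
  set V : Set ℝ := {v | ∃ (m : ℕ) (a : Fin m → ι → 𝕜),
    familyGauge F e ρ a ≤ 1 ∧ v = familyValue F x s a} with hV
  have hne : (0 : ℝ) ∈ V := by
    refine ⟨0, Fin.elim0, ?_, by simp [familyValue]⟩
    simp only [familyGauge, Finset.univ_eq_empty, Finset.sum_empty]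
    rw [Real.zero_rpow (by positivity)]
    simp
  have hle : ∀ v ∈ V, v ≤ S₀ := by
    rintro v ⟨m, a, ha, rfl⟩
    refine (H m a).trans ?_
    have : familyGauge F e ρ a ^ (s / ρ) ≤ 1 :=
      Real.rpow_le_one (familyGauge_nonneg _ _ _ _) ha (by positivity)
    nlinarith
  have hbdd : BddAbove V := ⟨S₀, hle⟩
  refine ⟨sSup V, le_csSup hbdd hne, csSup_le ⟨0, hne⟩ hle, fun m a => ?_, fun δ hδ => ?_⟩
  -- Gauge zero is settled by the a priori bound `H`, since `0 ^ (s / ρ) = 0`. Otherwise scaling the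
  -- family by `G ^ (-1/ρ)` makes its gauge equal to one.
  · rcases (familyGauge_nonneg F e ρ a).eq_or_lt with h0 | hpos
    · have h1 := H m a
      rw [← h0, Real.zero_rpow (by positivity), mul_zero] at h1 ⊢
      exact h1
    · set G := familyGauge F e ρ a with hG
      have ht : 0 ≤ G ^ (-(1 / ρ)) := Real.rpow_nonneg hpos.le _
      have hmem : (G ^ (-(1 / ρ))) ^ s * familyValue F x s a ∈ V := by
        refine ⟨m, fun k i => ((G ^ (-(1 / ρ)) : ℝ) : 𝕜) * a k i, ?_,
          (familyValue_smul F x s a ht).symm⟩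
        rw [familyGauge_smul F he ρ a ht, ← hG, ← Real.rpow_mul hpos.le]
        have : -(1 / ρ) * ρ = -1 := by field_simp
        rw [this, Real.rpow_neg_one, inv_mul_cancel₀ hpos.ne']
      have h2 := le_csSup hbdd hmem
      rw [← Real.rpow_mul hpos.le] at h2
      have h3 : G ^ (-(1 / ρ) * s) * G ^ (s / ρ) = 1 := by
        rw [← Real.rpow_add hpos]
        have : -(1 / ρ) * s + s / ρ = 0 := by ring
        rw [this, Real.rpow_zero]
      have h4 : 0 < G ^ (s / ρ) := Real.rpow_pos_of_pos hpos _
      calc familyValue F x s a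
          = G ^ (-(1 / ρ) * s) * G ^ (s / ρ) * familyValue F x s a := by rw [h3, one_mul]
        _ = G ^ (-(1 / ρ) * s) * familyValue F x s a * G ^ (s / ρ) := by ring
        _ ≤ _ := by gcongr
  · obtain ⟨v, ⟨m, a, ha, rfl⟩, hv⟩ :=
      exists_lt_of_lt_csSup ⟨0, hne⟩ (show sSup V - δ < sSup V by linarith)
    exact ⟨m, a, ha, hv.le⟩

/-- The inequality obtained from the best constant by adding a vector to a near-extremal family. -/
lemma value_insert_le {F : Finset ι} {x : ι → X} {s e ρ S : ℝ} (hs : 0 < s)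
    (hsρ : s ≤ ρ) (hS : 0 ≤ S)
    (H : ∀ (m : ℕ) (a : Fin m → ι → 𝕜),
      familyValue F x s a ≤ S * familyGauge F e ρ a ^ (s / ρ))
    {m : ℕ} (a : Fin m → ι → 𝕜) {z : ℝ} (hz : 0 ≤ z) (ha : familyGauge F e ρ a ≤ 1 + z) :
    familyValue F x s a ≤ S * (1 + z) := by
  have hρ : 0 < ρ := hs.trans_le hsρ
  refine (H m a).trans (mul_le_mul_of_nonneg_left ?_ hS)
  -- As `s / ρ ≤ 1 ≤ 1 + z`, the exponent may be raised to one. A bound linear in `z` can later be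
  -- compared with the value of a near-extremal family.
  calc familyGauge F e ρ a ^ (s / ρ) ≤ (1 + z) ^ (s / ρ) :=
        Real.rpow_le_rpow (familyGauge_nonneg _ _ _ _) ha (by positivity)
    _ ≤ (1 + z) ^ (1 : ℝ) :=
        Real.rpow_le_rpow_of_exponent_le (by linarith) ((div_le_one hρ).2 hsρ)
    _ = 1 + z := Real.rpow_one _

/-- The chord of the convex function `t ^ ρ` over `[1, 2]` lies above its graph. -/
lemma one_add_rpow_le {ρ g : ℝ} (hρ : 1 ≤ ρ) (h0 : 0 ≤ g) (h1 : g ≤ 1) :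
    (1 + g) ^ ρ ≤ 1 + 2 ^ ρ * g := by
  have h := (convexOn_rpow hρ).2 (show (1 : ℝ) ∈ Set.Ici 0 by simp)
    (show (2 : ℝ) ∈ Set.Ici 0 by simp) (sub_nonneg.2 h1) h0 (by ring)
  simp only [smul_eq_mul, Real.one_rpow, mul_one] at h
  have e : 1 - g + g * 2 = 1 + g := by ring
  rw [e] at h
  linarith

/-- Convexity of `‖·‖ ^ s` at the midpoint `u` of `v` and `w`. It serves to compare a family with
its two perturbations by the factors `1 ± ‖c i‖`. -/
lemma two_mul_norm_rpow_le (𝕜 : Type*) {E : Type*} [RCLike 𝕜] [NormedAddCommGroup E]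
    [NormedSpace 𝕜 E] {s : ℝ} (hs : 1 ≤ s) (u v w : E) (h : u + u = v + w) :
    2 * ‖u‖ ^ s ≤ ‖v‖ ^ s + ‖w‖ ^ s := by
  have h2 : ‖u‖ ≤ 1 / 2 * ‖v‖ + 1 / 2 * ‖w‖ := by
    have e : ‖u + u‖ = 2 * ‖u‖ := by
      rw [← two_smul 𝕜 u, norm_smul]; simp
    have := norm_add_le v w
    rw [← h, e] at this
    linarith
  have h3 := (convexOn_rpow hs).2 (show ‖v‖ ∈ Set.Ici (0 : ℝ) from norm_nonneg _)
    (show ‖w‖ ∈ Set.Ici (0 : ℝ) from norm_nonneg _) (show (0 : ℝ) ≤ 1 / 2 by norm_num)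
    (show (0 : ℝ) ≤ 1 / 2 by norm_num) (by norm_num)
  simp only [smul_eq_mul] at h3
  have h4 := Real.rpow_le_rpow (norm_nonneg u) h2 (by linarith : 0 ≤ s)
  linarith

/-- A density associated with a near-extremal family for an `(s, 1)`-concavity inequality. -/
lemma exists_density_of_one_concave (F : Finset ι) (x : ι → X) {s ρ S₀ δ : ℝ} (hs : 1 ≤ s)
    (hsρ : s ≤ ρ) (hS₀ : 0 ≤ S₀) (hδ : 0 < δ)
    (H : ∀ (m : ℕ) (a : Fin m → ι → 𝕜),
      familyValue F x s a ≤ S₀ * familyGauge F 1 ρ a ^ (s / ρ)) :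
    ∃ b : ι → ℝ, (∀ i, 0 ≤ b i) ∧ ∑ i ∈ F, b i ^ ρ ≤ 1 ∧
      (∀ c : ι → 𝕜, (∀ i ∈ F, ‖c i‖ ≤ 1) →
        ‖∑ i ∈ F, ((b i : 𝕜) * c i) • x i‖ ^ s ≤
          2 * δ + S₀ * (2 ^ ρ * ∑ i ∈ F, b i ^ ρ * ‖c i‖)) ∧
      ∀ i ∈ F, ∀ t, 0 ≤ t → (t * ‖x i‖) ^ s ≤ δ + S₀ * ((b i + t) ^ ρ - b i ^ ρ) := by
  classical
  have hs0 : 0 < s := by linarith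
  have hρ0 : 0 < ρ := by linarith
  obtain ⟨S, hS, hSS₀, HS, hext⟩ := exists_best_constant F x hs0 one_pos hρ0 hS₀ H
  obtain ⟨m, a, ha, hval⟩ := hext δ hδ
  set b : ι → ℝ := fun i => ∑ k, ‖a k i‖ with hb
  have hb0 : ∀ i, 0 ≤ b i := fun i => Finset.sum_nonneg fun _ _ => norm_nonneg _
  have hb1 : ∑ i ∈ F, b i ^ ρ ≤ 1 := by simpa [familyGauge, hb] using ha
  refine ⟨b, hb0, hb1, fun c hc => ?_, fun i hi t ht => ?_⟩
  · have hZ : 0 ≤ ∑ i ∈ F, b i ^ ρ * ‖c i‖ := Finset.sum_nonneg fun i _ =>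
      mul_nonneg (Real.rpow_nonneg (hb0 i) _) (norm_nonneg _)
    have hplus : familyValue F x s (fun k i => ((1 + ‖c i‖ : ℝ) : 𝕜) * a k i) ≤
        S * (1 + 2 ^ ρ * ∑ i ∈ F, b i ^ ρ * ‖c i‖) := by
      refine value_insert_le hs0 hsρ hS HS _ (by positivity) ?_
      simp only [familyGauge, Real.rpow_one, div_one, norm_mul, RCLike.norm_ofReal,
        ← Finset.mul_sum]
      calc ∑ i ∈ F, (|1 + ‖c i‖| * ∑ k, ‖a k i‖) ^ ρ
          ≤ ∑ i ∈ F, (b i ^ ρ + 2 ^ ρ * (b i ^ ρ * ‖c i‖)) := by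
            refine Finset.sum_le_sum fun i hi => ?_
            have h1 : 0 ≤ 1 + ‖c i‖ := by positivity
            rw [abs_of_nonneg h1, Real.mul_rpow h1 (hb0 i)]
            have := one_add_rpow_le (by linarith : 1 ≤ ρ) (norm_nonneg (c i)) (hc i hi)
            have h2 := mul_le_mul_of_nonneg_right this (Real.rpow_nonneg (hb0 i) ρ)
            simp only [hb] at h2 ⊢
            linarith
        _ = ∑ i ∈ F, b i ^ ρ + 2 ^ ρ * ∑ i ∈ F, b i ^ ρ * ‖c i‖ := by
            rw [Finset.sum_add_distrib, Finset.mul_sum]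
        _ ≤ _ := by linarith
    -- Shrinking the family by `1 - ‖c i‖` leaves exactly the room needed for one more vector `b i *
    -- c i`: the inner sum at `i` is again `b i`, so the gauge stays at most one.
    have hminus : ‖∑ i ∈ F, ((b i : 𝕜) * c i) • x i‖ ^ s +
        familyValue F x s (fun k i => ((1 - ‖c i‖ : ℝ) : 𝕜) * a k i) ≤ S := by
      have h := value_insert_le hs0 hsρ hS HS
        (Fin.cons (fun i => (b i : 𝕜) * c i) (fun k i => ((1 - ‖c i‖ : ℝ) : 𝕜) * a k i))
        le_rfl ?_
      · simpa [familyValue, Fin.sum_univ_succ] using h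
      · simp only [familyGauge, Real.rpow_one, div_one, Fin.sum_univ_succ, Fin.cons_zero,
          Fin.cons_succ, norm_mul, RCLike.norm_ofReal, ← Finset.mul_sum, add_zero]
        refine le_trans (Finset.sum_le_sum fun i hi => le_of_eq ?_) hb1
        congr 1
        rw [abs_of_nonneg (hb0 i), abs_of_nonneg (sub_nonneg.2 (hc i hi))]
        simp only [hb]; ring
    -- The family is the midpoint of its two perturbations, so the value of the added vector is at
    -- most `S + S * (1 + Z) - 2 * (S - δ)`, with `Z` the gauge increment allowed in `hplus`. The
    -- two copies of `S` cancel and `2 * δ + S * Z` remains.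
    have hmid : 2 * familyValue F x s a ≤
        familyValue F x s (fun k i => ((1 - ‖c i‖ : ℝ) : 𝕜) * a k i) +
          familyValue F x s (fun k i => ((1 + ‖c i‖ : ℝ) : 𝕜) * a k i) := by
      simp only [familyValue, Finset.mul_sum, ← Finset.sum_add_distrib]
      refine Finset.sum_le_sum fun k _ => two_mul_norm_rpow_le 𝕜 hs _ _ _ ?_
      simp only [← Finset.sum_add_distrib, ← add_smul]
      refine Finset.sum_congr rfl fun i _ => ?_
      congr 1
      push_cast
      ring
    have hSle : S * (2 ^ ρ * ∑ i ∈ F, b i ^ ρ * ‖c i‖) ≤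
        S₀ * (2 ^ ρ * ∑ i ∈ F, b i ^ ρ * ‖c i‖) := by gcongr
    linarith
  -- Adjoining the multiple `t` of the `i`-th unit vector. This estimate serves to show that `x i =
  -- 0` wherever the limiting density vanishes.
  · have hmono : 0 ≤ (b i + t) ^ ρ - b i ^ ρ :=
      sub_nonneg.2 (Real.rpow_le_rpow (hb0 i) (by linarith) hρ0.le)
    have h := value_insert_le hs0 hsρ hS HS (Fin.cons (Pi.single i (t : 𝕜)) a) hmono ?_
    · have e : ∑ j ∈ F, (Pi.single i (t : 𝕜) : ι → 𝕜) j • x j = (t : 𝕜) • x i := by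
        rw [Finset.sum_eq_single i]
        · simp
        · intro j _ hj; simp [hj]
        · intro h; exact absurd hi h
      have e2 : familyValue F x s (Fin.cons (Pi.single i (t : 𝕜)) a) =
          (t * ‖x i‖) ^ s + familyValue F x s a := by
        simp only [familyValue, Fin.sum_univ_succ, Fin.cons_zero, Fin.cons_succ, e]
        rw [norm_smul, RCLike.norm_ofReal, abs_of_nonneg ht]
      rw [e2] at h
      have := mul_le_mul_of_nonneg_right hSS₀ hmono
      linarith
    · simp only [familyGauge, Real.rpow_one, div_one, Fin.sum_univ_succ, Fin.cons_zero,
          Fin.cons_succ]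
      rw [← Finset.add_sum_erase _ _ hi] at hb1 ⊢
      have e3 : ∑ j ∈ F.erase i, (‖(Pi.single i (t : 𝕜) : ι → 𝕜) j‖ + ∑ k, ‖a k j‖) ^ ρ =
          ∑ j ∈ F.erase i, b j ^ ρ := by
        refine Finset.sum_congr rfl fun j hj => ?_
        simp [Finset.ne_of_mem_erase hj, hb]
      rw [e3]
      simp only [Pi.single_eq_same, RCLike.norm_ofReal, abs_of_nonneg ht]
      have : t + ∑ k, ‖a k i‖ = b i + t := by simp only [hb]; ring
      rw [this]
      linarith

/-- A density associated with a near-extremal family for a `2`-concavity inequality. -/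
lemma exists_density_of_two_concave (F : Finset ι) (x : ι → X) {ρ S₀ δ : ℝ}
    (hρ : 2 ≤ ρ) (hS₀ : 0 ≤ S₀) (hδ : 0 < δ)
    (H : ∀ (m : ℕ) (a : Fin m → ι → 𝕜),
      familyValue F x 2 a ≤ S₀ * familyGauge F 2 ρ a ^ (2 / ρ)) :
    ∃ B : ι → ℝ, (∀ i, 0 ≤ B i) ∧ ∑ i ∈ F, B i ^ (ρ / 2) ≤ 1 ∧
      ∀ c : ι → 𝕜, ‖∑ i ∈ F, c i • x i‖ ^ (2 : ℝ) ≤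
        δ + S₀ * ∑ i ∈ F, ((B i + ‖c i‖ ^ (2 : ℝ)) ^ (ρ / 2) - B i ^ (ρ / 2)) := by
  obtain ⟨S, hS, hSS₀, HS, hext⟩ :=
    exists_best_constant F x two_pos two_pos (by linarith) hS₀ H
  obtain ⟨m, a, ha, hval⟩ := hext δ hδ
  set B : ι → ℝ := fun i => ∑ k, ‖a k i‖ ^ (2 : ℝ) with hB
  have hB0 : ∀ i, 0 ≤ B i := fun i =>
    Finset.sum_nonneg fun _ _ => Real.rpow_nonneg (norm_nonneg _) _
  refine ⟨B, hB0, ha, fun c => ?_⟩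
  have hmono : 0 ≤ ∑ i ∈ F, ((B i + ‖c i‖ ^ (2 : ℝ)) ^ (ρ / 2) - B i ^ (ρ / 2)) :=
    Finset.sum_nonneg fun i _ => sub_nonneg.2 (Real.rpow_le_rpow (hB0 i)
      (le_add_of_nonneg_right (Real.rpow_nonneg (norm_nonneg _) _)) (by linarith))
  have h := value_insert_le two_pos hρ hS HS (Fin.cons c a) hmono ?_
  · have e2 : familyValue F x 2 (Fin.cons c a : Fin (m + 1) → ι → 𝕜) =
        ‖∑ i ∈ F, c i • x i‖ ^ (2 : ℝ) + familyValue F x 2 a := by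
      simp only [familyValue, Fin.sum_univ_succ, Fin.cons_zero, Fin.cons_succ]
    rw [e2] at h
    have := mul_le_mul_of_nonneg_right hSS₀ hmono
    linarith
  · simp only [familyGauge, Fin.sum_univ_succ, Fin.cons_zero, Fin.cons_succ,
      Finset.sum_sub_distrib] at ha ⊢
    simp only [add_comm (‖c _‖ ^ (2 : ℝ))]
    linarith

end Families

/-! ### From densities to Maurey weights: dyadic summation and ultralimits. -/

section Weights

open Filter Topology

variable {𝕜 X : Type*} [RCLike 𝕜] [NormedAddCommGroup X] [NormedSpace 𝕜 X]

/-- Dyadic summation of a restricted estimate on vectors bounded by one. -/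
lemma norm_sum_le_of_restricted_dyadic {F : Finset ℕ} {x : ℕ → X} {b : ℕ → ℝ} {K ρ s q : ℝ}
    (hb : ∀ i, 0 ≤ b i) (hK : 0 ≤ K) (hs : 1 ≤ s) (hsq : s < q) (hb1 : ∑ i ∈ F, b i ^ ρ ≤ 1)
    (hP : ∀ c : ℕ → 𝕜, (∀ i ∈ F, ‖c i‖ ≤ 1) →
      ‖∑ i ∈ F, ((b i : 𝕜) * c i) • x i‖ ^ s ≤ K * ∑ i ∈ F, b i ^ ρ * ‖c i‖) (M : ℕ) :
    ∀ c : ℕ → 𝕜, (∀ i ∈ F, ‖c i‖ ≤ 2 ^ M) → ∑ i ∈ F, b i ^ ρ * ‖c i‖ ^ q ≤ 1 →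
      ‖∑ i ∈ F, ((b i : 𝕜) * c i) • x i‖ ≤
        (K * 2 ^ q) ^ (1 / s) * ∑ m ∈ Finset.range (M + 1), ((2 : ℝ) ^ ((s - q) / s)) ^ m := by
  have hs0 : 0 < s := by linarith
  have hq0 : 0 < q := by linarith
  have hbρ : ∀ i, 0 ≤ b i ^ ρ := fun i => Real.rpow_nonneg (hb i) _
  have h2q : (1 : ℝ) ≤ 2 ^ q := Real.one_le_rpow (by norm_num) hq0.le
  have root : ∀ {u v : ℝ}, 0 ≤ u → u ^ s ≤ v → u ≤ v ^ (1 / s) := by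
    intro u v hu h
    calc u = (u ^ s) ^ (1 / s) := by
          rw [← Real.rpow_mul hu, mul_one_div_cancel hs0.ne', Real.rpow_one]
      _ ≤ v ^ (1 / s) := Real.rpow_le_rpow (Real.rpow_nonneg hu _) h (by positivity)
  induction M with
  | zero =>
    intro c hc _
    simp only [pow_zero] at hc
    simp only [zero_add, Finset.range_one, Finset.sum_singleton, pow_zero, mul_one]
    refine root (norm_nonneg _) ((hP c hc).trans ?_)
    refine mul_le_mul_of_nonneg_left ?_ hK
    refine le_trans (Finset.sum_le_sum fun i hi => ?_) (hb1.trans h2q)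
    exact mul_le_of_le_one_right (hbρ i) (hc i hi)
  | succ M ih =>
    intro c hc hcq
    classical
    -- `c₂` is the dyadic layer `2 ^ M < ‖c i‖ ≤ 2 ^ (M + 1)`. There `‖c i‖ / 2 ^ (M + 1) ≤ 1 ≤ (‖c
    -- i‖ / 2 ^ M) ^ q`, so the restricted estimate bounds the layer by `2 ^ (M + 1) * (K * 2 ^ (-M
    -- q)) ^ (1 / s)`. This is a geometric term; the factor `2 ^ q` in the constant absorbs the
    -- shift from `M` to `M + 1`.
    set c₁ : ℕ → 𝕜 := fun i => if ‖c i‖ ≤ 2 ^ M then c i else 0 with hc₁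
    set c₂ : ℕ → 𝕜 := fun i => if ‖c i‖ ≤ 2 ^ M then 0 else c i with hc₂
    have hsum : ∑ i ∈ F, ((b i : 𝕜) * c i) • x i =
        ∑ i ∈ F, ((b i : 𝕜) * c₁ i) • x i + ∑ i ∈ F, ((b i : 𝕜) * c₂ i) • x i := by
      rw [← Finset.sum_add_distrib]
      refine Finset.sum_congr rfl fun i _ => ?_
      simp only [hc₁, hc₂]
      split_ifs <;> simp
    have h1 := ih c₁ (fun i _ => ?_) (le_trans (Finset.sum_le_sum fun i _ => ?_) hcq)
    rotate_left
    · simp only [hc₁]; split_ifs with h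
      · exact h
      · simp
    · refine mul_le_mul_of_nonneg_left (Real.rpow_le_rpow (norm_nonneg _) ?_ hq0.le) (hbρ i)
      simp only [hc₁]; split_ifs <;> simp
    set τ : ℝ := 2 ^ (M + 1) with hτ
    have hτ0 : 0 < τ := by positivity
    have h2 : ‖∑ i ∈ F, ((b i : 𝕜) * c₂ i) • x i‖ ≤
        (K * 2 ^ q) ^ (1 / s) * ((2 : ℝ) ^ ((s - q) / s)) ^ (M + 1) := by
      have h3 := hP (fun i => ((τ⁻¹ : ℝ) : 𝕜) * c₂ i) (fun i hi => ?_)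
      · have e1 : ∑ i ∈ F, ((b i : 𝕜) * (((τ⁻¹ : ℝ) : 𝕜) * c₂ i)) • x i =
            ((τ⁻¹ : ℝ) : 𝕜) • ∑ i ∈ F, ((b i : 𝕜) * c₂ i) • x i := by
          rw [Finset.smul_sum]
          refine Finset.sum_congr rfl fun i _ => ?_
          rw [smul_smul]; congr 1; ring
        rw [e1, norm_smul, RCLike.norm_ofReal, abs_of_pos (inv_pos.2 hτ0)] at h3
        have h4 : ∑ i ∈ F, b i ^ ρ * ‖((τ⁻¹ : ℝ) : 𝕜) * c₂ i‖ ≤ ((2 : ℝ) ^ M) ^ (-q) := by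
          calc ∑ i ∈ F, b i ^ ρ * ‖((τ⁻¹ : ℝ) : 𝕜) * c₂ i‖
              ≤ ∑ i ∈ F, ((2 : ℝ) ^ M) ^ (-q) * (b i ^ ρ * ‖c i‖ ^ q) := by
                refine Finset.sum_le_sum fun i hi => ?_
                rw [mul_left_comm]
                refine mul_le_mul_of_nonneg_left ?_ (hbρ i)
                simp only [hc₂]
                split_ifs with h
                · simp only [mul_zero, norm_zero]; positivity
                · rw [norm_mul, RCLike.norm_ofReal, abs_of_pos (inv_pos.2 hτ0)]
                  have ha : τ⁻¹ * ‖c i‖ ≤ 1 := by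
                    rw [inv_mul_le_iff₀ hτ0, mul_one]; exact hc i hi
                  refine ha.trans ?_
                  rw [Real.rpow_neg (by positivity), inv_mul_eq_div, one_le_div (by positivity)]
                  exact Real.rpow_le_rpow (by positivity) (not_le.1 h).le hq0.le
            _ = ((2 : ℝ) ^ M) ^ (-q) * ∑ i ∈ F, b i ^ ρ * ‖c i‖ ^ q := by rw [Finset.mul_sum]
            _ ≤ ((2 : ℝ) ^ M) ^ (-q) * 1 := by gcongr
            _ = _ := mul_one _
        have h5 := root (by positivity) (h3.trans (mul_le_mul_of_nonneg_left h4 hK))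
        rw [inv_mul_le_iff₀ hτ0] at h5
        refine h5.trans (le_of_eq ?_)
        rw [Real.mul_rpow hK (by positivity), Real.mul_rpow hK (by positivity)]
        have e2 : τ * (((2 : ℝ) ^ M) ^ (-q)) ^ (1 / s) =
            ((2 : ℝ) ^ q) ^ (1 / s) * ((2 : ℝ) ^ ((s - q) / s)) ^ (M + 1) := by
          rw [hτ, ← Real.rpow_natCast, ← Real.rpow_natCast, ← Real.rpow_natCast,
            ← Real.rpow_mul (by norm_num), ← Real.rpow_mul (by norm_num),
            ← Real.rpow_mul (by norm_num), ← Real.rpow_mul (by norm_num),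
            ← Real.rpow_add (by norm_num), ← Real.rpow_add (by norm_num)]
          congr 1
          push_cast
          field_simp
          ring
        calc τ * (K ^ (1 / s) * (((2 : ℝ) ^ M) ^ (-q)) ^ (1 / s))
            = K ^ (1 / s) * (τ * (((2 : ℝ) ^ M) ^ (-q)) ^ (1 / s)) := by ring
          _ = _ := by rw [e2]; ring
      · rw [norm_mul, RCLike.norm_ofReal, abs_of_pos (inv_pos.2 hτ0), inv_mul_le_iff₀ hτ0, mul_one]
        simp only [hc₂]
        split_ifs
        · simp only [norm_zero]; positivity
        · exact hc i hi
    rw [hsum, Finset.sum_range_succ, mul_add]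
    exact (norm_add_le _ _).trans (add_le_add h1 h2)

/-- A restricted estimate on vectors bounded by one yields an `L_q` estimate for `q > s`. -/
lemma norm_sum_le_of_restricted {F : Finset ℕ} {x : ℕ → X} {b : ℕ → ℝ} {K ρ s q : ℝ}
    (hb : ∀ i, 0 ≤ b i) (hK : 0 ≤ K) (hs : 1 ≤ s) (hsq : s < q) (hb1 : ∑ i ∈ F, b i ^ ρ ≤ 1)
    (hP : ∀ c : ℕ → 𝕜, (∀ i ∈ F, ‖c i‖ ≤ 1) →
      ‖∑ i ∈ F, ((b i : 𝕜) * c i) • x i‖ ^ s ≤ K * ∑ i ∈ F, b i ^ ρ * ‖c i‖) (c : ℕ → 𝕜) :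
    ‖∑ i ∈ F, ((b i : 𝕜) * c i) • x i‖ ≤
      (K * 2 ^ q) ^ (1 / s) * (1 - (2 : ℝ) ^ ((s - q) / s))⁻¹ *
        (∑ i ∈ F, b i ^ ρ * ‖c i‖ ^ q) ^ (1 / q) := by
  have hs0 : 0 < s := by linarith
  have hq0 : 0 < q := by linarith
  have hγ0 : (0 : ℝ) ≤ 2 ^ ((s - q) / s) := by positivity
  have hγ1 : (2 : ℝ) ^ ((s - q) / s) < 1 :=
    Real.rpow_lt_one_of_one_lt_of_neg (by norm_num) (div_neg_of_neg_of_pos (by linarith) hs0)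
  have unit : ∀ c : ℕ → 𝕜, ∑ i ∈ F, b i ^ ρ * ‖c i‖ ^ q ≤ 1 →
      ‖∑ i ∈ F, ((b i : 𝕜) * c i) • x i‖ ≤
        (K * 2 ^ q) ^ (1 / s) * (1 - (2 : ℝ) ^ ((s - q) / s))⁻¹ := by
    intro c hc
    -- The number of layers depends on `c`, but since `s < q` the geometric series bounds them all
    -- by one constant.
    obtain ⟨M, hM⟩ := pow_unbounded_of_one_lt (∑ i ∈ F, ‖c i‖) (one_lt_two : (1 : ℝ) < 2)
    refine (norm_sum_le_of_restricted_dyadic hb hK hs hsq hb1 hP M c (fun i hi => ?_) hc).trans ?_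
    · exact (Finset.single_le_sum (fun i _ => norm_nonneg (c i)) hi).trans hM.le
    · refine mul_le_mul_of_nonneg_left ?_ (by positivity)
      exact (summable_geometric_of_lt_one hγ0 hγ1).sum_le_tsum _ (fun _ _ => by positivity)
        |>.trans_eq (tsum_geometric_of_lt_one hγ0 hγ1)
  set G := ∑ i ∈ F, b i ^ ρ * ‖c i‖ ^ q with hG
  have hterm : ∀ i, 0 ≤ b i ^ ρ * ‖c i‖ ^ q := fun i =>
    mul_nonneg (Real.rpow_nonneg (hb i) _) (Real.rpow_nonneg (norm_nonneg _) _)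
  have hG0 : 0 ≤ G := Finset.sum_nonneg fun i _ => hterm i
  rcases hG0.eq_or_lt with h0 | hpos
  · have : ∑ i ∈ F, ((b i : 𝕜) * c i) • x i = 0 := by
      refine Finset.sum_eq_zero fun i hi => ?_
      have h := (Finset.sum_eq_zero_iff_of_nonneg fun i _ => hterm i).1 h0.symm i hi
      have hbc : b i = 0 ∨ c i = 0 := by
        by_contra! hne
        have := mul_pos (Real.rpow_pos_of_pos ((hb i).lt_of_ne' hne.1) ρ)
          (Real.rpow_pos_of_pos (norm_pos_iff.2 hne.2) q)
        exact this.ne' h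
      rcases hbc with h | h <;> simp [h]
    rw [this, norm_zero, ← h0, Real.zero_rpow (by positivity), mul_zero]
  · set A := G ^ (1 / q) with hA
    have hApos : 0 < A := Real.rpow_pos_of_pos hpos _
    have hAq : A ^ q = G := by
      rw [hA, ← Real.rpow_mul hG0, one_div_mul_cancel hq0.ne', Real.rpow_one]
    have h := unit (fun i => ((A⁻¹ : ℝ) : 𝕜) * c i) ?_
    · have e1 : ∑ i ∈ F, ((b i : 𝕜) * (((A⁻¹ : ℝ) : 𝕜) * c i)) • x i =
          ((A⁻¹ : ℝ) : 𝕜) • ∑ i ∈ F, ((b i : 𝕜) * c i) • x i := by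
        rw [Finset.smul_sum]
        refine Finset.sum_congr rfl fun i _ => ?_
        rw [smul_smul]; congr 1; ring
      rw [e1, norm_smul, RCLike.norm_ofReal, abs_of_pos (inv_pos.2 hApos),
        inv_mul_le_iff₀ hApos] at h
      linarith
    · simp only [norm_mul, RCLike.norm_ofReal, abs_of_pos (inv_pos.2 hApos)]
      have : ∀ i, b i ^ ρ * (A⁻¹ * ‖c i‖) ^ q = (A ^ q)⁻¹ * (b i ^ ρ * ‖c i‖ ^ q) := by
        intro i
        rw [Real.mul_rpow (by positivity) (norm_nonneg _), Real.inv_rpow hApos.le]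
        ring
      simp only [this, ← Finset.mul_sum]
      rw [hAq, ← hG, inv_mul_cancel₀ hpos.ne']

/-- Coordinatewise ultralimits of truncated densities. -/
lemma exists_hyperfilter_limit {ρ : ℝ} (hρ : 0 < ρ) (b : ℕ → ℕ → ℝ) (hb : ∀ N i, 0 ≤ b N i)
    (hb1 : ∀ N, ∑ i ∈ Finset.range N, b N i ^ ρ ≤ 1) :
    ∃ β : ℕ → ℝ, (∀ i, 0 ≤ β i) ∧ (∀ F : Finset ℕ, ∑ i ∈ F, β i ^ ρ ≤ 1) ∧
      ∀ i, Tendsto (fun N => b N i) (hyperfilter ℕ : Filter ℕ) (𝓝 (β i)) := by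
  have hev : ∀ n : ℕ, ∀ᶠ N in (hyperfilter ℕ : Filter ℕ), n ≤ N := fun n =>
    (Nat.cofinite_eq_atTop ▸ hyperfilter_le_cofinite (α := ℕ)) (eventually_ge_atTop n)
  -- Once `i < N`, the bound on the sum confines `b N i` to `[0, 1]`. One ultrafilter gives the
  -- limits in all coordinates at once.
  have hlim : ∀ i, ∃ β ∈ Set.Icc (0 : ℝ) 1,
      Tendsto (fun N => b N i) (hyperfilter ℕ : Filter ℕ) (𝓝 β) := by
    intro i
    have hmem : ∀ᶠ N in (hyperfilter ℕ : Filter ℕ), b N i ∈ Set.Icc (0 : ℝ) 1 := by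
      filter_upwards [hev (i + 1)] with N hN
      refine ⟨hb N i, ?_⟩
      have h := (Finset.single_le_sum (f := fun j => b N j ^ ρ)
        (fun j _ => Real.rpow_nonneg (hb N j) _)
        (Finset.mem_range.2 (by omega : i < N))).trans (hb1 N)
      by_contra! hlt
      exact (Real.one_lt_rpow hlt hρ).not_ge h
    obtain ⟨β, hβ, hle⟩ := isCompact_Icc.ultrafilter_le_nhds
      ((hyperfilter ℕ).map fun N => b N i) (le_principal_iff.2 hmem)
    exact ⟨β, hβ, hle⟩
  choose β hβ hlim using hlim
  refine ⟨β, fun i => (hβ i).1, fun F => ?_, hlim⟩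
  refine le_of_tendsto (tendsto_finsetSum F fun i _ =>
    (hlim i).rpow_const (Or.inr hρ.le)) ?_
  obtain ⟨n, hn⟩ := F.exists_nat_subset_range
  filter_upwards [hev n] with N hN
  exact (Finset.sum_le_sum_of_subset_of_nonneg (hn.trans (Finset.range_subset_range.2 hN))
    fun i _ _ => Real.rpow_nonneg (hb N i) _).trans (hb1 N)

lemma sum_extend_eq {M : Type*} [AddCommMonoid M] {F G : Finset ℕ} (hFG : F ⊆ G) (c : ℕ → 𝕜)
    (f : ℕ → 𝕜 → M) (hf : ∀ i, f i 0 = 0) :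
    ∑ i ∈ G, f i (if i ∈ F then c i else 0) = ∑ i ∈ F, f i (c i) := by
  rw [← Finset.sum_subset hFG fun i _ hi => by simp [hi, hf]]
  exact Finset.sum_congr rfl fun i hi => by simp [hi]

lemma hyperfilter_eventually_subset_range (F : Finset ℕ) :
    ∀ᶠ N in (hyperfilter ℕ : Filter ℕ), F ⊆ Finset.range N := by
  obtain ⟨n, hn⟩ := F.exists_nat_subset_range
  have : ∀ᶠ N in (hyperfilter ℕ : Filter ℕ), n ≤ N :=
    (Nat.cofinite_eq_atTop ▸ hyperfilter_le_cofinite (α := ℕ)) (eventually_ge_atTop n)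
  filter_upwards [this] with N hN using hn.trans (Finset.range_subset_range.2 hN)

lemma tendsto_one_div_hyperfilter :
    Tendsto (fun N : ℕ => 1 / ((N : ℝ) + 1)) (hyperfilter ℕ : Filter ℕ) (𝓝 0) :=
  tendsto_one_div_add_atTop_nhds_zero_nat.mono_left
    (Nat.cofinite_eq_atTop ▸ hyperfilter_le_cofinite (α := ℕ))

/-- Maurey-type weight for `(s, 1)`-concave operators on `ℓ_ρ`, with `s < q < ρ`. -/
lemma exists_weight_of_one_concave (x : ℕ → X) {s q ρ S₀ : ℝ} (hs : 1 ≤ s) (hsq : s < q)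
    (hqρ : q < ρ) (hS₀ : 0 ≤ S₀)
    (H : ∀ (N m : ℕ) (a : Fin m → ℕ → 𝕜), familyValue (Finset.range N) x s a ≤
      S₀ * familyGauge (Finset.range N) 1 ρ a ^ (s / ρ)) :
    ∃ (K : ℝ) (b : ℕ → ℝ), 0 ≤ K ∧ (∀ i, 0 ≤ b i) ∧ (∀ F : Finset ℕ, ∑ i ∈ F, b i ^ ρ ≤ 1) ∧
      ∀ (F : Finset ℕ) (c : ℕ → 𝕜),
        ‖∑ i ∈ F, c i • x i‖ ^ q ≤ K * ∑ i ∈ F, b i ^ (ρ - q) * ‖c i‖ ^ q := by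
  have hs0 : 0 < s := by linarith
  have hρ0 : 0 < ρ := by linarith
  have hq0 : 0 < q := by linarith
  -- The truncation to `Finset.range N` is given slack `1 / (N + 1)`, which disappears in the
  -- ultralimit.
  have hδ : ∀ N : ℕ, (0 : ℝ) < 1 / ((N : ℝ) + 1) := fun N => by positivity
  choose b hb hb1 hbP hbx using fun N : ℕ =>
    exists_density_of_one_concave (𝕜 := 𝕜) (Finset.range N) x hs (hsq.trans hqρ).le hS₀ (hδ N) (H N)
  obtain ⟨β, hβ, hβ1, hlim⟩ := exists_hyperfilter_limit hρ0 b hb hb1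
  have hP : ∀ (F : Finset ℕ) (c : ℕ → 𝕜), (∀ i ∈ F, ‖c i‖ ≤ 1) →
      ‖∑ i ∈ F, ((β i : 𝕜) * c i) • x i‖ ^ s ≤
        (S₀ * 2 ^ ρ) * ∑ i ∈ F, β i ^ ρ * ‖c i‖ := by
    intro F c hc
    have hl : Tendsto (fun N => ‖∑ i ∈ F, ((b N i : 𝕜) * c i) • x i‖ ^ s)
        (hyperfilter ℕ : Filter ℕ) (𝓝 (‖∑ i ∈ F, ((β i : 𝕜) * c i) • x i‖ ^ s)) := by
      refine Tendsto.rpow_const ?_ (Or.inr hs0.le)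
      refine (tendsto_finsetSum F fun i _ => Tendsto.smul_const (Tendsto.mul_const _ ?_) _).norm
      exact (RCLike.continuous_ofReal.tendsto (β i)).comp (hlim i)
    have hr : Tendsto (fun N : ℕ => 2 * (1 / ((N : ℝ) + 1)) +
          S₀ * (2 ^ ρ * ∑ i ∈ F, b N i ^ ρ * ‖c i‖)) (hyperfilter ℕ : Filter ℕ)
        (𝓝 (2 * 0 + S₀ * (2 ^ ρ * ∑ i ∈ F, β i ^ ρ * ‖c i‖))) :=
      (tendsto_one_div_hyperfilter.const_mul 2).add
        (((tendsto_finsetSum F fun i _ =>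
          ((hlim i).rpow_const (Or.inr hρ0.le)).mul_const _).const_mul _).const_mul _)
    have := le_of_tendsto_of_tendsto hl hr ?_
    · linarith
    · filter_upwards [hyperfilter_eventually_subset_range F] with N hN
      have h := hbP N (fun i => if i ∈ F then c i else 0) (fun i _ => ?_)
      · rwa [sum_extend_eq hN c (fun i z => ((b N i : 𝕜) * z) • x i) (by simp),
          sum_extend_eq hN c (fun i z => b N i ^ ρ * ‖z‖) (by simp)] at h
      · split_ifs with hi
        · exact hc i hi
        · simp
  -- If `β i = 0`, the unit-vector estimate becomes `(t * ‖x i‖) ^ s ≤ S₀ * t ^ ρ` with `s < ρ`;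
  -- divide by `t ^ s` and let `t` tend to zero.
  have hx : ∀ i, β i = 0 → x i = 0 := by
    intro i hi
    have h1 : ∀ t : ℝ, 0 ≤ t → (t * ‖x i‖) ^ s ≤ S₀ * t ^ ρ := by
      intro t ht
      have hr : Tendsto (fun N : ℕ => 1 / ((N : ℝ) + 1) + S₀ * ((b N i + t) ^ ρ - b N i ^ ρ))
          (hyperfilter ℕ : Filter ℕ) (𝓝 (0 + S₀ * ((β i + t) ^ ρ - β i ^ ρ))) :=
        tendsto_one_div_hyperfilter.add
          (((((hlim i).add_const t).rpow_const (Or.inr hρ0.le)).sub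
            ((hlim i).rpow_const (Or.inr hρ0.le))).const_mul _)
      rw [hi, zero_add, zero_add, Real.zero_rpow hρ0.ne', sub_zero] at hr
      refine ge_of_tendsto hr ?_
      filter_upwards [hyperfilter_eventually_subset_range {i}] with N hN
      exact hbx N i (hN (Finset.mem_singleton_self i)) t ht
    have h2 : ‖x i‖ ^ s ≤ 0 := by
      have hr : Tendsto (fun t : ℝ => S₀ * t ^ (ρ - s)) (𝓝[>] 0) (𝓝 (S₀ * 0 ^ (ρ - s))) :=
        ((((continuous_id.tendsto (0 : ℝ)).rpow_const
          (Or.inr (by linarith : 0 ≤ ρ - s))).const_mul S₀)).mono_left nhdsWithin_le_nhds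
      rw [Real.zero_rpow (by linarith), mul_zero] at hr
      refine ge_of_tendsto hr ?_
      filter_upwards [self_mem_nhdsWithin] with t (ht : 0 < t)
      have h := h1 t ht.le
      rw [Real.mul_rpow ht.le (norm_nonneg _), mul_comm, ← le_div_iff₀ (by positivity)] at h
      rwa [Real.rpow_sub ht, ← mul_div_assoc]
    by_contra hne
    exact (Real.rpow_pos_of_pos (norm_pos_iff.2 hne) s).not_ge h2
  set K₁ := ((S₀ * 2 ^ ρ) * 2 ^ q) ^ (1 / s) * (1 - (2 : ℝ) ^ ((s - q) / s))⁻¹ with hK₁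
  have hK₁0 : 0 ≤ K₁ := by
    have hγ1 : (2 : ℝ) ^ ((s - q) / s) < 1 :=
      Real.rpow_lt_one_of_one_lt_of_neg (by norm_num) (div_neg_of_neg_of_pos (by linarith) hs0)
    exact mul_nonneg (by positivity) (inv_nonneg.2 (by linarith))
  refine ⟨K₁ ^ q, β, by positivity, hβ, hβ1, fun F c => ?_⟩
  -- The substitution of `c i / β i` for `c i` moves the density into the weight. Where `β i = 0`
  -- the inverse is zero by convention, which is harmless because `x i = 0` there.
  have h := norm_sum_le_of_restricted hβ (by positivity : 0 ≤ S₀ * 2 ^ ρ) hs hsq (hβ1 F) (hP F)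
    (fun i => (((β i)⁻¹ : ℝ) : 𝕜) * c i)
  have e1 : ∑ i ∈ F, ((β i : 𝕜) * ((((β i)⁻¹ : ℝ) : 𝕜) * c i)) • x i = ∑ i ∈ F, c i • x i := by
    refine Finset.sum_congr rfl fun i _ => ?_
    by_cases hi : β i = 0
    · simp [hx i hi]
    · rw [← mul_assoc, ← RCLike.ofReal_mul, mul_inv_cancel₀ hi, RCLike.ofReal_one, one_mul]
  have e2 : ∑ i ∈ F, β i ^ ρ * ‖(((β i)⁻¹ : ℝ) : 𝕜) * c i‖ ^ q =
      ∑ i ∈ F, β i ^ (ρ - q) * ‖c i‖ ^ q := by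
    refine Finset.sum_congr rfl fun i _ => ?_
    rw [norm_mul, RCLike.norm_ofReal, abs_of_nonneg (inv_nonneg.2 (hβ i)),
      Real.mul_rpow (inv_nonneg.2 (hβ i)) (norm_nonneg _), ← mul_assoc]
    congr 1
    rcases (hβ i).eq_or_lt with h0 | hpos
    · rw [← h0, Real.zero_rpow hρ0.ne', Real.zero_rpow (by linarith), zero_mul]
    · rw [Real.inv_rpow hpos.le, Real.rpow_sub hpos, div_eq_mul_inv]
  rw [e1, e2, ← hK₁] at h
  have hG0 : 0 ≤ ∑ i ∈ F, β i ^ (ρ - q) * ‖c i‖ ^ q := Finset.sum_nonneg fun i _ =>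
    mul_nonneg (Real.rpow_nonneg (hβ i) _) (Real.rpow_nonneg (norm_nonneg _) _)
  have h' := Real.rpow_le_rpow (norm_nonneg _) h hq0.le
  rwa [Real.mul_rpow hK₁0 (by positivity), ← Real.rpow_mul hG0, one_div_mul_cancel hq0.ne',
    Real.rpow_one] at h'

/-- Maurey-type weight for `2`-concave operators on `ℓ_ρ`, with `2 < ρ`. -/
lemma exists_weight_of_two_concave (x : ℕ → X) {ρ S₀ : ℝ} (hρ : 2 < ρ) (hS₀ : 0 ≤ S₀)
    (H : ∀ (N m : ℕ) (a : Fin m → ℕ → 𝕜), familyValue (Finset.range N) x 2 a ≤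
      S₀ * familyGauge (Finset.range N) 2 ρ a ^ (2 / ρ)) :
    ∃ (K : ℝ) (b : ℕ → ℝ), 0 ≤ K ∧ (∀ i, 0 ≤ b i) ∧ (∀ F : Finset ℕ, ∑ i ∈ F, b i ^ ρ ≤ 1) ∧
      ∀ (F : Finset ℕ) (c : ℕ → 𝕜),
        ‖∑ i ∈ F, c i • x i‖ ^ (2 : ℝ) ≤ K * ∑ i ∈ F, b i ^ (ρ - 2) * ‖c i‖ ^ (2 : ℝ) := by
  have hδ : ∀ N : ℕ, (0 : ℝ) < 1 / ((N : ℝ) + 1) := fun N => by positivity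
  have hρ2 : 0 < ρ / 2 := by linarith
  choose b hb hb1 hbP using fun N : ℕ =>
    exists_density_of_two_concave (𝕜 := 𝕜) (Finset.range N) x hρ.le hS₀ (hδ N) (H N)
  obtain ⟨β, hβ, hβ1, hlim⟩ := exists_hyperfilter_limit hρ2 b hb hb1
  have hP : ∀ (F : Finset ℕ) (c : ℕ → 𝕜), ‖∑ i ∈ F, c i • x i‖ ^ (2 : ℝ) ≤
      S₀ * ∑ i ∈ F, ((β i + ‖c i‖ ^ (2 : ℝ)) ^ (ρ / 2) - β i ^ (ρ / 2)) := by
    intro F c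
    have hr : Tendsto (fun N : ℕ => 1 / ((N : ℝ) + 1) +
          S₀ * ∑ i ∈ F, ((b N i + ‖c i‖ ^ (2 : ℝ)) ^ (ρ / 2) - b N i ^ (ρ / 2)))
        (hyperfilter ℕ : Filter ℕ)
        (𝓝 (0 + S₀ * ∑ i ∈ F, ((β i + ‖c i‖ ^ (2 : ℝ)) ^ (ρ / 2) - β i ^ (ρ / 2)))) :=
      tendsto_one_div_hyperfilter.add ((tendsto_finsetSum F fun i _ =>
        (((hlim i).add_const _).rpow_const (Or.inr hρ2.le)).sub
          ((hlim i).rpow_const (Or.inr hρ2.le))).const_mul _)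
    rw [zero_add] at hr
    refine ge_of_tendsto hr ?_
    filter_upwards [hyperfilter_eventually_subset_range F] with N hN
    have h := hbP N (fun i => if i ∈ F then c i else 0)
    rwa [sum_extend_eq hN c (fun i z => z • x i) (by simp),
      sum_extend_eq hN c
        (fun i z => (b N i + ‖z‖ ^ (2 : ℝ)) ^ (ρ / 2) - b N i ^ (ρ / 2)) (by simp)] at h
  -- Replacing `c` by `√t • c`, dividing by `t` and letting `t` decrease to zero turns the
  -- increments of `y ^ (ρ / 2)` into its derivative at `β i`. The additive slack had to be removed
  -- first, as it would not survive the division.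
  have hQ : ∀ (F : Finset ℕ) (c : ℕ → 𝕜), ‖∑ i ∈ F, c i • x i‖ ^ (2 : ℝ) ≤
      S₀ * ∑ i ∈ F, ρ / 2 * β i ^ (ρ / 2 - 1) * ‖c i‖ ^ (2 : ℝ) := by
    intro F c
    have hder : ∀ i, Tendsto (fun t : ℝ => t⁻¹ *
        ((β i + t * ‖c i‖ ^ (2 : ℝ)) ^ (ρ / 2) - β i ^ (ρ / 2))) (𝓝[>] 0)
        (𝓝 (ρ / 2 * β i ^ (ρ / 2 - 1) * ‖c i‖ ^ (2 : ℝ))) := by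
      intro i
      have h1 : HasDerivAt (fun t : ℝ => β i + t * ‖c i‖ ^ (2 : ℝ)) (‖c i‖ ^ (2 : ℝ)) 0 := by
        simpa using ((hasDerivAt_id (0 : ℝ)).mul_const (‖c i‖ ^ (2 : ℝ))).const_add (β i)
      have h2 := h1.rpow_const (p := ρ / 2) (Or.inr (by linarith))
      have h3 := h2.tendsto_slope_zero_right
      simp only [zero_add, zero_mul, add_zero, smul_eq_mul] at h3
      convert h3 using 2
      ring
    have hr := (tendsto_finsetSum F fun i _ => hder i).const_mul S₀
    refine ge_of_tendsto hr ?_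
    filter_upwards [self_mem_nhdsWithin] with t (ht : 0 < t)
    have h := hP F (fun i => ((Real.sqrt t : ℝ) : 𝕜) * c i)
    have hst : (Real.sqrt t) ^ (2 : ℝ) = t := by
      rw [Real.rpow_two, Real.sq_sqrt ht.le]
    simp only [mul_smul, ← Finset.smul_sum] at h
    rw [norm_smul] at h
    simp only [norm_mul, RCLike.norm_ofReal, abs_of_nonneg (Real.sqrt_nonneg t),
      Real.mul_rpow (Real.sqrt_nonneg t) (norm_nonneg _), hst] at h
    rw [← Finset.mul_sum, mul_left_comm, ← div_eq_inv_mul, le_div_iff₀ ht, mul_comm]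
    exact h
  -- Here `β` is a limit of sums of squares, so the weight is its square root: `β ^ (ρ / 2 - 1) = (β
  -- ^ (1 / 2)) ^ (ρ - 2)`.
  refine ⟨S₀ * (ρ / 2), fun i => β i ^ (1 / 2 : ℝ), by positivity,
    fun i => Real.rpow_nonneg (hβ i) _, fun F => ?_, fun F c => ?_⟩
  · simpa only [← Real.rpow_mul (hβ _), one_div_mul_eq_div] using hβ1 F
  · refine (hQ F c).trans (le_of_eq ?_)
    rw [mul_assoc S₀, Finset.mul_sum _ _ (ρ / 2)]
    congr 1
    refine Finset.sum_congr rfl fun i _ => ?_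
    rw [← Real.rpow_mul (hβ i), mul_assoc]
    congr 3
    ring

end Weights

/-! ### Khintchine's inequality by exponential moments. -/

section Khintchine

/-- The signs are independent, so the sum factors into `∏ 2 cosh (t k)`, and `cosh t ≤ exp (t² /
2)`. -/
lemma sum_signs_exp_le {m : ℕ} (t : Fin m → ℝ) :
    ∑ ε : Fin m → ℤˣ, Real.exp (∑ k, ((ε k : ℤ) : ℝ) * t k) ≤
      2 ^ m * Real.exp ((∑ k, t k ^ 2) / 2) := by
  have h1 : ∑ ε : Fin m → ℤˣ, Real.exp (∑ k, ((ε k : ℤ) : ℝ) * t k) =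
      ∏ k, ∑ e : ℤˣ, Real.exp (((e : ℤ) : ℝ) * t k) := by
    rw [Finset.prod_univ_sum, Fintype.piFinset_univ]
    exact Finset.sum_congr rfl fun ε _ => Real.exp_sum _ _
  have h2 : ∀ k, ∑ e : ℤˣ, Real.exp (((e : ℤ) : ℝ) * t k) ≤ 2 * Real.exp (t k ^ 2 / 2) := by
    intro k
    have h3 := Real.cosh_le_exp_half_sq (t k)
    have h4 : ∑ e : ℤˣ, Real.exp (((e : ℤ) : ℝ) * t k) = 2 * Real.cosh (t k) := by
      rw [Real.cosh_eq, UnitsInt.univ, Finset.sum_pair (by decide)]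
      simp
      ring
    rw [h4]
    linarith
  rw [h1]
  refine (Finset.prod_le_prod (fun k _ => Finset.sum_nonneg fun _ _ => (Real.exp_pos _).le)
    fun k _ => h2 k).trans (le_of_eq ?_)
  rw [Finset.prod_mul_distrib, ← Real.exp_sum, Finset.sum_div]
  simp

lemma abs_rpow_le_exp {ρ : ℝ} (hρ : 0 ≤ ρ) (y : ℝ) :
    |y| ^ ρ ≤ (1 + (⌈ρ⌉₊.factorial : ℝ)) * (Real.exp y + Real.exp (-y)) := by
  set n := ⌈ρ⌉₊
  have h0 := abs_nonneg y
  have h1 : |y| ^ ρ ≤ 1 + |y| ^ n := by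
    rcases le_total |y| 1 with h | h
    · exact (Real.rpow_le_one h0 h hρ).trans (le_add_of_nonneg_right (by positivity))
    · rw [← Real.rpow_natCast]
      exact (Real.rpow_le_rpow_of_exponent_le h (Nat.le_ceil ρ)).trans (by linarith)
  have h2 : |y| ^ n ≤ n.factorial * Real.exp |y| := by
    have := Real.pow_div_factorial_le_exp |y| h0 n
    rwa [div_le_iff₀' (by positivity)] at this
  have h3 : 1 ≤ Real.exp |y| := Real.one_le_exp h0
  have h4 : Real.exp |y| ≤ Real.exp y + Real.exp (-y) := by
    have hp := Real.exp_pos y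
    have hn := Real.exp_pos (-y)
    rcases abs_cases y with ⟨h, _⟩ | ⟨h, _⟩ <;> rw [h] <;> linarith
  calc |y| ^ ρ ≤ (1 + (n.factorial : ℝ)) * Real.exp |y| := by linarith
    _ ≤ _ := by gcongr

/-- Khintchine's inequality for real coefficients. -/
lemma khintchine_real {ρ : ℝ} (hρ : 0 < ρ) : ∃ C : ℝ, 0 ≤ C ∧ ∀ (m : ℕ) (t : Fin m → ℝ),
    ∑ ε : Fin m → ℤˣ, |∑ k, ((ε k : ℤ) : ℝ) * t k| ^ ρ ≤
      2 ^ m * (C * (∑ k, t k ^ 2) ^ (ρ / 2)) := by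
  set D : ℝ := 1 + (⌈ρ⌉₊.factorial : ℝ)
  refine ⟨2 * D * Real.exp (1 / 2), by positivity, fun m t => ?_⟩
  have unit : ∀ t : Fin m → ℝ, ∑ k, t k ^ 2 = 1 →
      ∑ ε : Fin m → ℤˣ, |∑ k, ((ε k : ℤ) : ℝ) * t k| ^ ρ ≤ 2 ^ m * (2 * D * Real.exp (1 / 2)) := by
    intro t ht
    have hp := sum_signs_exp_le t
    have hn := sum_signs_exp_le (fun k => - t k)
    simp only [mul_neg, Finset.sum_neg_distrib, even_two, Even.neg_pow, ht] at hp hn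
    calc _ ≤ ∑ ε : Fin m → ℤˣ, D * (Real.exp (∑ k, ((ε k : ℤ) : ℝ) * t k) +
          Real.exp (-∑ k, ((ε k : ℤ) : ℝ) * t k)) :=
          Finset.sum_le_sum fun ε _ => abs_rpow_le_exp hρ.le _
      _ = D * (∑ ε : Fin m → ℤˣ, Real.exp (∑ k, ((ε k : ℤ) : ℝ) * t k) +
          ∑ ε : Fin m → ℤˣ, Real.exp (-∑ k, ((ε k : ℤ) : ℝ) * t k)) := by
          rw [← Finset.mul_sum, Finset.sum_add_distrib]
      _ ≤ D * (2 ^ m * Real.exp (1 / 2) + 2 ^ m * Real.exp (1 / 2)) := by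
          have hD : 0 ≤ D := by positivity
          gcongr
      _ = _ := by ring
  have hV0 : 0 ≤ ∑ k, t k ^ 2 := Finset.sum_nonneg fun _ _ => sq_nonneg _
  rcases hV0.eq_or_lt with h0 | hpos
  · have ht : ∀ k, t k = 0 := fun k => by
      have := (Finset.sum_eq_zero_iff_of_nonneg fun k _ => sq_nonneg (t k)).1 h0.symm k
        (Finset.mem_univ k)
      simpa using this
    simp only [ht, mul_zero, Finset.sum_const_zero, abs_zero, Real.zero_rpow hρ.ne']
    positivity
  · set V := ∑ k, t k ^ 2 with hV
    have hsV : 0 < Real.sqrt V := Real.sqrt_pos.2 hpos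
    have h := unit (fun k => (Real.sqrt V)⁻¹ * t k) (by
      simp only [mul_pow, ← Finset.mul_sum, inv_pow, Real.sq_sqrt hV0]
      rw [← hV, inv_mul_cancel₀ hpos.ne'])
    have e : ∀ ε : Fin m → ℤˣ, |∑ k, ((ε k : ℤ) : ℝ) * t k| ^ ρ =
        V ^ (ρ / 2) * |∑ k, ((ε k : ℤ) : ℝ) * ((Real.sqrt V)⁻¹ * t k)| ^ ρ := by
      intro ε
      have e1 : ∑ k, ((ε k : ℤ) : ℝ) * ((Real.sqrt V)⁻¹ * t k) =
          (Real.sqrt V)⁻¹ * ∑ k, ((ε k : ℤ) : ℝ) * t k := by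
        rw [Finset.mul_sum]; exact Finset.sum_congr rfl fun k _ => by ring
      have e2 : V ^ (ρ / 2) = Real.sqrt V ^ ρ := by
        rw [Real.sqrt_eq_rpow, ← Real.rpow_mul hV0]; congr 1; ring
      rw [e1, abs_mul, abs_of_pos (inv_pos.2 hsV), e2,
        ← Real.mul_rpow hsV.le (by positivity), mul_inv_cancel_left₀ hsV.ne']
    simp only [e, ← Finset.mul_sum]
    calc _ ≤ V ^ (ρ / 2) * (2 ^ m * (2 * D * Real.exp (1 / 2))) := by gcongr
      _ = _ := by ring

/-- Khintchine's inequality for real or complex coefficients. -/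
lemma khintchine (𝕜 : Type*) [RCLike 𝕜] {ρ : ℝ} (hρ : 0 < ρ) :
    ∃ C : ℝ, 0 ≤ C ∧ ∀ (m : ℕ) (z : Fin m → 𝕜),
      ∑ ε : Fin m → ℤˣ, ‖∑ k, (((ε k : ℤ) : ℝ) : 𝕜) * z k‖ ^ ρ ≤
        2 ^ m * (C * (∑ k, ‖z k‖ ^ (2 : ℝ)) ^ (ρ / 2)) := by
  obtain ⟨C, hC, H⟩ := khintchine_real hρ
  refine ⟨2 ^ ρ * (2 * C), by positivity, fun m z => ?_⟩
  have hnorm : ∀ w : 𝕜, ‖w‖ ^ ρ ≤ 2 ^ ρ * (|RCLike.re w| ^ ρ + |RCLike.im w| ^ ρ) := by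
    intro w
    have h1 : ‖w‖ ≤ 2 * max |RCLike.re w| |RCLike.im w| := by
      -- Only an inequality is available, because `RCLike.I` is zero over the reals.
      have hI : ‖(RCLike.I : 𝕜)‖ ≤ 1 := by
        rw [RCLike.norm_I]; split_ifs <;> norm_num
      have h := norm_add_le ((RCLike.re w : ℝ) : 𝕜) ((RCLike.im w : ℝ) * RCLike.I)
      rw [RCLike.re_add_im, norm_mul, RCLike.norm_ofReal, RCLike.norm_ofReal] at h
      have := mul_le_of_le_one_right (abs_nonneg (RCLike.im w)) hI
      have := le_max_left |RCLike.re w| |RCLike.im w|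
      have := le_max_right |RCLike.re w| |RCLike.im w|
      linarith
    have hm : 0 ≤ max |RCLike.re w| |RCLike.im w| := (abs_nonneg _).trans (le_max_left _ _)
    refine (Real.rpow_le_rpow (norm_nonneg _) h1 hρ.le).trans ?_
    rw [Real.mul_rpow (by norm_num) hm]
    gcongr
    have h3 : 0 ≤ |RCLike.re w| ^ ρ := by positivity
    have h4 : 0 ≤ |RCLike.im w| ^ ρ := by positivity
    rcases max_choice |RCLike.re w| |RCLike.im w| with h | h <;> rw [h] <;> linarith
  have hre : ∀ ε : Fin m → ℤˣ, RCLike.re (∑ k, (((ε k : ℤ) : ℝ) : 𝕜) * z k) =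
      ∑ k, ((ε k : ℤ) : ℝ) * RCLike.re (z k) := by
    intro ε; rw [map_sum]; exact Finset.sum_congr rfl fun k _ => RCLike.re_ofReal_mul _ _
  have him : ∀ ε : Fin m → ℤˣ, RCLike.im (∑ k, (((ε k : ℤ) : ℝ) : 𝕜) * z k) =
      ∑ k, ((ε k : ℤ) : ℝ) * RCLike.im (z k) := by
    intro ε; rw [map_sum]; exact Finset.sum_congr rfl fun k _ => RCLike.im_ofReal_mul _ _
  have hle : ∀ f : 𝕜 → ℝ, (∀ w, |f w| ≤ ‖w‖) →
      ∑ ε : Fin m → ℤˣ, |∑ k, ((ε k : ℤ) : ℝ) * f (z k)| ^ ρ ≤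
        2 ^ m * (C * (∑ k, ‖z k‖ ^ (2 : ℝ)) ^ (ρ / 2)) := by
    intro f hf
    refine (H m fun k => f (z k)).trans ?_
    have : ∀ k, f (z k) ^ 2 ≤ ‖z k‖ ^ (2 : ℝ) := fun k => by
      rw [Real.rpow_two, ← sq_abs]
      exact pow_le_pow_left₀ (abs_nonneg _) (hf _) 2
    have h0 : 0 ≤ ∑ k, f (z k) ^ 2 := Finset.sum_nonneg fun _ _ => sq_nonneg _
    gcongr with k
    exact this k
  calc _ ≤ ∑ ε : Fin m → ℤˣ, 2 ^ ρ * (|∑ k, ((ε k : ℤ) : ℝ) * RCLike.re (z k)| ^ ρ +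
        |∑ k, ((ε k : ℤ) : ℝ) * RCLike.im (z k)| ^ ρ) := by
        refine Finset.sum_le_sum fun ε _ => ?_
        rw [← hre, ← him]
        exact hnorm _
    _ = 2 ^ ρ * (∑ ε : Fin m → ℤˣ, |∑ k, ((ε k : ℤ) : ℝ) * RCLike.re (z k)| ^ ρ +
        ∑ ε : Fin m → ℤˣ, |∑ k, ((ε k : ℤ) : ℝ) * RCLike.im (z k)| ^ ρ) := by
        rw [← Finset.mul_sum, Finset.sum_add_distrib]
    _ ≤ 2 ^ ρ * (2 ^ m * (C * (∑ k, ‖z k‖ ^ (2 : ℝ)) ^ (ρ / 2)) +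
        2 ^ m * (C * (∑ k, ‖z k‖ ^ (2 : ℝ)) ^ (ρ / 2))) := by
        gcongr
        · exact hle _ RCLike.abs_re_le_norm
        · exact hle _ RCLike.abs_im_le_norm
    _ = _ := by ring

end Khintchine

/-! ### Cotype as concavity of operators on `ℓ_ρ`. -/

section Cotype

variable {𝕜 X : Type*} [RCLike 𝕜] [NormedAddCommGroup X] [NormedSpace 𝕜 X]

lemma HasCotype.sum_rpow_le {s : ℝ} (hs : 0 < s) (hX : HasCotype s X) :
    ∃ C : ℝ, 0 ≤ C ∧ ∀ (m : ℕ) (x : Fin m → X),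
      ∑ i, ‖x i‖ ^ s ≤
        (C * Real.sqrt ((∑ ε : Fin m → ℤˣ, ‖∑ i, ((ε i : ℤˣ) : ℤ) • x i‖ ^ 2) / 2 ^ m)) ^ s := by
  obtain ⟨C, hC⟩ := hX
  refine ⟨|C|, abs_nonneg C, fun m x => ?_⟩
  have h0 : 0 ≤ ∑ i, ‖x i‖ ^ s :=
    Finset.sum_nonneg fun _ _ => Real.rpow_nonneg (norm_nonneg _) _
  have h1 := (hC m x).trans (mul_le_mul_of_nonneg_right (le_abs_self C) (Real.sqrt_nonneg _))
  have h2 := Real.rpow_le_rpow (by positivity) h1 hs.le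
  rwa [← Real.rpow_mul h0, one_div_mul_cancel hs.ne', Real.rpow_one] at h2

/-- The average over signs is at most the maximum. This cruder form suffices wherever the available
bound does not depend on the signs. -/
lemma HasCotype.sum_rpow_le_of_forall_le {s : ℝ} (hs : 0 < s) (hX : HasCotype s X) :
    ∃ C : ℝ, 0 ≤ C ∧ ∀ (m : ℕ) (x : Fin m → X) (R : ℝ), 0 ≤ R →
      (∀ ε : Fin m → ℤˣ, ‖∑ i, ((ε i : ℤˣ) : ℤ) • x i‖ ≤ R) →
      ∑ i, ‖x i‖ ^ s ≤ (C * R) ^ s := by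
  obtain ⟨C, hC, H⟩ := hX.sum_rpow_le hs
  refine ⟨C, hC, fun m x R hR hle => (H m x).trans ?_⟩
  refine Real.rpow_le_rpow (by positivity) (mul_le_mul_of_nonneg_left ?_ hC) hs.le
  refine Real.sqrt_le_iff.2 ⟨hR, ?_⟩
  rw [div_le_iff₀ (by positivity)]
  calc ∑ ε : Fin m → ℤˣ, ‖∑ i, ((ε i : ℤˣ) : ℤ) • x i‖ ^ 2
      ≤ ∑ _ε : Fin m → ℤˣ, R ^ 2 :=
        Finset.sum_le_sum fun ε _ => pow_le_pow_left₀ (norm_nonneg _) (hle ε) 2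
    _ = R ^ 2 * 2 ^ m := by simp [mul_comm]

lemma sum_int_smul_sum_smul {ι κ : Type*} [Fintype κ] (F : Finset ι) (x : ι → X)
    (a : κ → ι → 𝕜) (ε : κ → ℤˣ) :
    ∑ k, ((ε k : ℤˣ) : ℤ) • ∑ i ∈ F, a k i • x i =
      ∑ i ∈ F, (∑ k, (((ε k : ℤ) : ℝ) : 𝕜) * a k i) • x i := by
  simp only [Finset.smul_sum, Finset.sum_smul]
  rw [Finset.sum_comm]
  refine Finset.sum_congr rfl fun i _ => Finset.sum_congr rfl fun k _ => ?_
  rw [mul_smul, ← Int.cast_smul_eq_zsmul 𝕜]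
  simp

lemma norm_int_units_cast (e : ℤˣ) : ‖(((e : ℤ) : ℝ) : 𝕜)‖ = 1 := by
  rcases Int.units_eq_one_or e with rfl | rfl <;> simp

/-- Operators from `ℓ_ρ` into a space of cotype `s` are `(s, 1)`-concave. -/
lemma HasCotype.one_concave {s ρ M : ℝ} (hs : 0 < s) (hρ : 0 < ρ) (hM : 0 ≤ M)
    (hX : HasCotype s X) (x : ℕ → X)
    (hx : ∀ (F : Finset ℕ) (c : ℕ → 𝕜),
      ‖∑ i ∈ F, c i • x i‖ ≤ M * (∑ i ∈ F, ‖c i‖ ^ ρ) ^ (1 / ρ)) :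
    ∃ S₀ : ℝ, 0 ≤ S₀ ∧ ∀ (N m : ℕ) (a : Fin m → ℕ → 𝕜),
      familyValue (Finset.range N) x s a ≤
        S₀ * familyGauge (Finset.range N) 1 ρ a ^ (s / ρ) := by
  obtain ⟨C, hC, H⟩ := hX.sum_rpow_le_of_forall_le hs
  refine ⟨(C * M) ^ s, by positivity, fun N m a => ?_⟩
  have hG := familyGauge_nonneg (Finset.range N) 1 ρ a
  refine (H m _ (M * familyGauge (Finset.range N) 1 ρ a ^ (1 / ρ)) (by positivity)
    fun ε => ?_).trans (le_of_eq ?_)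
  · rw [sum_int_smul_sum_smul]
    refine (hx _ _).trans (mul_le_mul_of_nonneg_left ?_ hM)
    refine Real.rpow_le_rpow (Finset.sum_nonneg fun _ _ => by positivity) ?_ (by positivity)
    refine Finset.sum_le_sum fun i _ => ?_
    simp only [Real.rpow_one, div_one]
    refine Real.rpow_le_rpow (norm_nonneg _) ((norm_sum_le _ _).trans_eq ?_) hρ.le
    exact Finset.sum_congr rfl fun k _ => by rw [norm_mul, norm_int_units_cast, one_mul]
  · rw [← mul_assoc, Real.mul_rpow (by positivity) (by positivity), ← Real.rpow_mul hG]
    congr 2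
    ring

/-- Operators from `ℓ_ρ`, `ρ ≥ 2`, into a space of cotype `2` are `2`-concave. -/
lemma HasCotype.two_concave {ρ M : ℝ} (hρ : 2 ≤ ρ) (hM : 0 ≤ M)
    (hX : HasCotype 2 X) (x : ℕ → X)
    (hx : ∀ (F : Finset ℕ) (c : ℕ → 𝕜),
      ‖∑ i ∈ F, c i • x i‖ ≤ M * (∑ i ∈ F, ‖c i‖ ^ ρ) ^ (1 / ρ)) :
    ∃ S₀ : ℝ, 0 ≤ S₀ ∧ ∀ (N m : ℕ) (a : Fin m → ℕ → 𝕜),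
      familyValue (Finset.range N) x 2 a ≤
        S₀ * familyGauge (Finset.range N) 2 ρ a ^ (2 / ρ) := by
  have hρ0 : 0 < ρ := by linarith
  obtain ⟨C, hC, H⟩ := hX.sum_rpow_le two_pos
  obtain ⟨D, hD, hK⟩ := khintchine 𝕜 hρ0
  refine ⟨C ^ 2 * (M ^ 2 * D ^ (2 / ρ)), by positivity, fun N m a => ?_⟩
  set F := Finset.range N
  have hG := familyGauge_nonneg F 2 ρ a
  set v : (Fin m → ℤˣ) → ℝ := fun ε => ‖∑ k, ((ε k : ℤˣ) : ℤ) • ∑ i ∈ F, a k i • x i‖ with hv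
  have hv0 : ∀ ε, 0 ≤ v ε := fun ε => norm_nonneg _
  -- In the `ρ`-th moment the sums over signs and over coordinates commute, so scalar Khintchine
  -- applies in each coordinate. Jensen, with `ρ ≥ 2`, then returns to the second moment of the
  -- cotype inequality.
  have hvρ : ∑ ε, v ε ^ ρ ≤ 2 ^ m * (M ^ ρ * (D * familyGauge F 2 ρ a)) := by
    calc ∑ ε, v ε ^ ρ
        ≤ ∑ ε : Fin m → ℤˣ, M ^ ρ * ∑ i ∈ F, ‖∑ k, (((ε k : ℤ) : ℝ) : 𝕜) * a k i‖ ^ ρ := by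
          refine Finset.sum_le_sum fun ε _ => ?_
          have hS : 0 ≤ ∑ i ∈ F, ‖∑ k, (((ε k : ℤ) : ℝ) : 𝕜) * a k i‖ ^ ρ :=
            Finset.sum_nonneg fun _ _ => by positivity
          have h := hx F fun i => ∑ k, (((ε k : ℤ) : ℝ) : 𝕜) * a k i
          rw [← sum_int_smul_sum_smul] at h
          have h' := Real.rpow_le_rpow (norm_nonneg _) h hρ0.le
          rwa [Real.mul_rpow hM (by positivity), ← Real.rpow_mul hS,
            one_div_mul_cancel hρ0.ne', Real.rpow_one] at h'
      _ = M ^ ρ * ∑ i ∈ F, ∑ ε : Fin m → ℤˣ, ‖∑ k, (((ε k : ℤ) : ℝ) : 𝕜) * a k i‖ ^ ρ := by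
          rw [← Finset.mul_sum, Finset.sum_comm]
      _ ≤ M ^ ρ * ∑ i ∈ F, 2 ^ m * (D * (∑ k, ‖a k i‖ ^ (2 : ℝ)) ^ (ρ / 2)) := by
          gcongr with i
          exact hK m _
      _ = _ := by
          simp only [← Finset.mul_sum, familyGauge]
          ring
  have hjensen : (∑ ε, v ε ^ 2) / 2 ^ m ≤ M ^ 2 * (D ^ (2 / ρ) * familyGauge F 2 ρ a ^ (2 / ρ)) := by
    have hw : ∑ _ε : Fin m → ℤˣ, ((2 : ℝ) ^ m)⁻¹ = 1 := by simp
    have h := Real.rpow_arith_mean_le_arith_mean_rpow (Finset.univ : Finset (Fin m → ℤˣ))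
      (fun _ => ((2 : ℝ) ^ m)⁻¹) (fun ε => v ε ^ 2) (fun _ _ => by positivity) hw
      (fun ε _ => sq_nonneg _) (show 1 ≤ ρ / 2 by linarith)
    simp only [← Finset.mul_sum] at h
    have e1 : ∀ ε, (v ε ^ 2) ^ (ρ / 2) = v ε ^ ρ := fun ε => by
      rw [← Real.rpow_two, ← Real.rpow_mul (hv0 ε)]; congr 1; ring
    simp only [e1] at h
    have h2 : ((2 : ℝ) ^ m)⁻¹ * ∑ ε, v ε ^ ρ ≤ M ^ ρ * (D * familyGauge F 2 ρ a) := by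
      rw [inv_mul_le_iff₀ (by positivity)]; exact hvρ
    have hs0 : 0 ≤ ((2 : ℝ) ^ m)⁻¹ * ∑ ε, v ε ^ 2 :=
      mul_nonneg (by positivity) (Finset.sum_nonneg fun _ _ => sq_nonneg _)
    have h3 := Real.rpow_le_rpow (by positivity) (h.trans h2) (by positivity : 0 ≤ 2 / ρ)
    rw [← Real.rpow_mul hs0, Real.mul_rpow (x := M ^ ρ) (by positivity) (mul_nonneg hD hG),
      Real.mul_rpow hD hG, ← Real.rpow_mul hM] at h3
    have e2 : ρ / 2 * (2 / ρ) = 1 := by field_simp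
    have e3 : ρ * (2 / ρ) = 2 := by field_simp
    rw [e2, e3, Real.rpow_one, Real.rpow_two] at h3
    rw [div_eq_inv_mul]
    exact h3
  refine (H m _).trans ?_
  have hE0 : 0 ≤ (∑ ε, v ε ^ 2) / 2 ^ m :=
    div_nonneg (Finset.sum_nonneg fun _ _ => sq_nonneg _) (by positivity)
  rw [Real.rpow_two, mul_pow, Real.sq_sqrt hE0, mul_assoc, mul_assoc]
  exact mul_le_mul_of_nonneg_left hjensen (by positivity)

end Cotype

/-! ### Weakly summable sequences as operators, and the factorization. -/

section WeakSummability

variable {𝕜 X : Type*} [RCLike 𝕜] [NormedAddCommGroup X] [NormedSpace 𝕜 X]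

lemma ofReal_sum_norm_rpow {ι : Type*} (F : Finset ι) (f : ι → 𝕜) {a : ℝ} (ha : 0 ≤ a) :
    ∑ i ∈ F, ‖f i‖ₑ ^ a = ENNReal.ofReal (∑ i ∈ F, ‖f i‖ ^ a) := by
  rw [ENNReal.ofReal_sum_of_nonneg fun _ _ => by positivity]
  refine Finset.sum_congr rfl fun i _ => ?_
  rw [← ofReal_norm, ENNReal.ofReal_rpow_of_nonneg (norm_nonneg _) ha]

lemma weaklySummable_ofReal_iff {a : ℝ} (ha : 0 < a) (x : ℕ → X) :
    WeaklySummable 𝕜 (ENNReal.ofReal a) x ↔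
      ∃ M : ℝ, 0 ≤ M ∧ ∀ φ : X →L[𝕜] 𝕜, ‖φ‖ ≤ 1 →
        ∀ F : Finset ℕ, ∑ i ∈ F, ‖φ (x i)‖ ^ a ≤ M := by
  rw [WeaklySummable, if_neg ENNReal.ofReal_ne_top, ENNReal.toReal_ofReal ha.le]
  constructor
  · intro h
    refine ⟨_, ENNReal.toReal_nonneg, fun φ hφ F => (ENNReal.ofReal_le_iff_le_toReal h.ne).1 ?_⟩
    rw [← ofReal_sum_norm_rpow F (fun i => φ (x i)) ha.le]
    exact (ENNReal.sum_le_tsum F).trans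
      (le_iSup₂ (f := fun (φ : X →L[𝕜] 𝕜) (_ : φ ∈ Metric.closedBall (0 : X →L[𝕜] 𝕜) 1) =>
        ∑' i, ‖φ (x i)‖ₑ ^ a) φ (by simpa using hφ))
  · rintro ⟨M, -, hM⟩
    refine lt_of_le_of_lt (iSup₂_le fun φ hφ => ?_) (ENNReal.ofReal_lt_top (r := M))
    rw [ENNReal.tsum_eq_iSup_sum]
    refine iSup_le fun F => ?_
    rw [ofReal_sum_norm_rpow F (fun i => φ (x i)) ha.le]
    exact ENNReal.ofReal_le_ofReal (hM φ (by simpa using hφ) F)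

/-- Weakly summable sequences are bounded. -/
lemma WeaklySummable.exists_norm_le {q : ℝ≥0∞} (hq : 0 < q) {x : ℕ → X}
    (hx : WeaklySummable 𝕜 q x) : ∃ M : ℝ, ∀ i, ‖x i‖ ≤ M := by
  by_cases hq' : q = ∞
  · rw [WeaklySummable, if_pos hq'] at hx
    refine ⟨_, fun i => (ENNReal.ofReal_le_iff_le_toReal hx.ne).1 ?_⟩
    obtain ⟨φ, hφ, hφx⟩ := exists_dual_vector'' 𝕜 (x i)
    have h1 : ENNReal.ofReal ‖x i‖ = ‖φ (x i)‖ₑ := by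
      rw [hφx, ← ofReal_norm, RCLike.norm_ofReal, abs_of_nonneg (norm_nonneg _)]
    rw [h1]
    exact (le_iSup (fun i => ‖φ (x i)‖ₑ) i).trans
      (le_iSup₂ (f := fun (φ : X →L[𝕜] 𝕜) (_ : φ ∈ Metric.closedBall (0 : X →L[𝕜] 𝕜) 1) =>
        ⨆ i, ‖φ (x i)‖ₑ) φ (by simpa using hφ))
  · have ha : 0 < q.toReal := ENNReal.toReal_pos hq.ne' hq'
    rw [← ENNReal.ofReal_toReal hq', weaklySummable_ofReal_iff ha] at hx
    obtain ⟨M, hM, H⟩ := hx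
    refine ⟨M ^ (1 / q.toReal), fun i => ?_⟩
    obtain ⟨φ, hφ, hφx⟩ := exists_dual_vector'' 𝕜 (x i)
    have h := H φ hφ {i}
    rw [Finset.sum_singleton, hφx, RCLike.norm_ofReal, abs_of_nonneg (norm_nonneg _)] at h
    calc ‖x i‖ = (‖x i‖ ^ q.toReal) ^ (1 / q.toReal) := by
          rw [← Real.rpow_mul (norm_nonneg _), mul_one_div_cancel ha.ne', Real.rpow_one]
      _ ≤ _ := Real.rpow_le_rpow (by positivity) h (by positivity)

lemma exists_functional_sum_le (F : Finset ℕ) (x : ℕ → X) (c : ℕ → 𝕜) :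
    ∃ φ : X →L[𝕜] 𝕜, ‖φ‖ ≤ 1 ∧ ‖∑ i ∈ F, c i • x i‖ ≤ ∑ i ∈ F, ‖c i‖ * ‖φ (x i)‖ := by
  obtain ⟨φ, hφ, hφx⟩ := exists_dual_vector'' 𝕜 (∑ i ∈ F, c i • x i)
  refine ⟨φ, hφ, ?_⟩
  calc ‖∑ i ∈ F, c i • x i‖ = ‖φ (∑ i ∈ F, c i • x i)‖ := by
        rw [hφx, RCLike.norm_ofReal, abs_of_nonneg (norm_nonneg _)]
    _ ≤ _ := by
        rw [map_sum]
        refine (norm_sum_le _ _).trans_eq (Finset.sum_congr rfl fun i _ => ?_)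
        rw [map_smul, norm_smul]

/-- A weakly `b`-summable sequence defines a bounded operator on `ℓ_ρ`, `1/b + 1/ρ = 1`. -/
lemma WeaklySummable.norm_sum_smul_le {b ρ : ℝ} (hbρ : ρ.HolderConjugate b) {x : ℕ → X}
    (hx : WeaklySummable 𝕜 (ENNReal.ofReal b) x) :
    ∃ M : ℝ, 0 ≤ M ∧ ∀ (F : Finset ℕ) (c : ℕ → 𝕜),
      ‖∑ i ∈ F, c i • x i‖ ≤ M * (∑ i ∈ F, ‖c i‖ ^ ρ) ^ (1 / ρ) := by
  obtain ⟨M, hM, H⟩ := (weaklySummable_ofReal_iff hbρ.symm.pos x).1 hx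
  refine ⟨M ^ (1 / b), by positivity, fun F c => ?_⟩
  obtain ⟨φ, hφ, h⟩ := exists_functional_sum_le F x c
  refine h.trans ((Real.inner_le_Lp_mul_Lq F (fun i => ‖c i‖) (fun i => ‖φ (x i)‖) hbρ).trans ?_)
  simp only [abs_norm]
  rw [mul_comm]
  have hb0 : 0 ≤ 1 / b := one_div_nonneg.2 hbρ.symm.nonneg
  exact mul_le_mul_of_nonneg_right (Real.rpow_le_rpow (Finset.sum_nonneg fun _ _ => by positivity)
    (H φ hφ F) hb0) (Real.rpow_nonneg (Finset.sum_nonneg fun _ _ => by positivity) _)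

/-- A bounded operator on `ℓ_q` gives a weakly `a`-summable sequence, `1/a + 1/q = 1`. -/
lemma weaklySummable_of_norm_sum_smul_le {a q K : ℝ} (haq : a.HolderConjugate q) (hK : 0 ≤ K)
    {w : ℕ → X} (hw : ∀ (F : Finset ℕ) (c : ℕ → 𝕜),
      ‖∑ i ∈ F, c i • w i‖ ^ q ≤ K * ∑ i ∈ F, ‖c i‖ ^ q) :
    WeaklySummable 𝕜 (ENNReal.ofReal a) w := by
  have ha1 := haq.lt
  have hq1 := haq.symm.lt
  refine (weaklySummable_ofReal_iff haq.pos w).2 ⟨K ^ (1 / (q - 1)), by positivity,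
    fun φ hφ F => ?_⟩
  -- The `c i` are the extremal coefficients in Hölder's inequality: `c i * φ (w i) = ‖φ (w i)‖ ^ a`
  -- and `‖c i‖ ^ q = ‖φ (w i)‖ ^ a`. Hence `S ^ q ≤ K * S`, which gives the bound `K ^ (1 / (q -
  -- 1))`.
  have key : ∀ z : 𝕜, ∃ c : 𝕜, c * z = ((‖z‖ ^ a : ℝ) : 𝕜) ∧ ‖c‖ = ‖z‖ ^ (a - 1) := by
    intro z
    by_cases hz : z = 0
    · refine ⟨0, ?_, ?_⟩
      · rw [hz, norm_zero, Real.zero_rpow haq.pos.ne']; simp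
      · rw [hz, norm_zero, Real.zero_rpow (by linarith)]
    · have hz' : 0 < ‖z‖ := norm_pos_iff.2 hz
      refine ⟨((‖z‖ ^ (a - 2) : ℝ) : 𝕜) * (starRingEnd 𝕜) z, ?_, ?_⟩
      · rw [mul_assoc, RCLike.conj_mul, ← RCLike.ofReal_pow, ← RCLike.ofReal_mul, ← Real.rpow_two,
          ← Real.rpow_add hz']
        congr 2; ring
      · rw [norm_mul, RCLike.norm_ofReal, RCLike.norm_conj,
          abs_of_nonneg (Real.rpow_nonneg hz'.le _)]
        rw [← Real.rpow_add_one hz'.ne']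
        congr 1; ring
  choose c hc1 hc2 using fun i => key (φ (w i))
  set S := ∑ i ∈ F, ‖φ (w i)‖ ^ a with hS
  have hS0 : 0 ≤ S := Finset.sum_nonneg fun _ _ => by positivity
  have h1 : S ≤ ‖∑ i ∈ F, c i • w i‖ := by
    have e : φ (∑ i ∈ F, c i • w i) = (S : 𝕜) := by
      rw [map_sum, hS, RCLike.ofReal_sum]
      refine Finset.sum_congr rfl fun i _ => ?_
      rw [map_smul, smul_eq_mul, hc1]
    have h := φ.le_of_opNorm_le hφ (∑ i ∈ F, c i • w i)
    rwa [e, RCLike.norm_ofReal, abs_of_nonneg hS0, one_mul] at h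
  have h2 : S ^ q ≤ K * S := by
    refine (Real.rpow_le_rpow hS0 h1 haq.symm.nonneg).trans ((hw F c).trans_eq ?_)
    congr 1
    refine Finset.sum_congr rfl fun i _ => ?_
    rw [hc2, ← Real.rpow_mul (norm_nonneg _), haq.sub_one_mul_conj]
  rcases hS0.eq_or_lt with h0 | hpos
  · rw [← h0]; positivity
  · have h3 : S ^ (q - 1) ≤ K := by
      rw [Real.rpow_sub_one hpos.ne', div_le_iff₀ hpos]; exact h2
    have hq0 : 0 < q - 1 := by linarith
    calc S = (S ^ (q - 1)) ^ (1 / (q - 1)) := by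
          rw [← Real.rpow_mul hS0, mul_one_div_cancel hq0.ne', Real.rpow_one]
      _ ≤ _ := Real.rpow_le_rpow (by positivity) h3 (by positivity)

/-- In a space of cotype `s`, unconditionally bounded sums are absolutely `s`-summable. -/
lemma HasCotype.summable_norm_rpow {s R : ℝ} (hs : 0 < s) (hX : HasCotype s X) {y : ℕ → X}
    (hR : 0 ≤ R)
    (hy : ∀ (F : Finset ℕ) (c : ℕ → 𝕜), (∀ i, ‖c i‖ ≤ 1) → ‖∑ i ∈ F, c i • y i‖ ≤ R) :
    Summable fun i => ‖y i‖ ^ s := by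
  obtain ⟨C, hC, H⟩ := hX.sum_rpow_le_of_forall_le hs
  refine summable_of_sum_range_le (c := (C * R) ^ s) (fun _ => by positivity) fun m => ?_
  rw [Finset.sum_range]
  refine H m (fun i => y i) R hR fun ε => ?_
  have h := hy (Finset.range m)
    (fun i => if h : i < m then (((ε ⟨i, h⟩ : ℤ) : ℝ) : 𝕜) else 0) fun i => ?_
  · rw [Finset.sum_range] at h
    convert h using 3 with i
    rw [dif_pos i.2, ← Int.cast_smul_eq_zsmul 𝕜]
    simp
  · split_ifs
    · rw [norm_int_units_cast]
    · simp

/-- In a space of cotype `σ`, weakly `b`-summable sequences, `1/b = (1-θ) + θ/a`, are products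
`λ ^ (1-θ) • w` with `w` weakly `a`-summable and `λ w` absolutely `σ`-summable. -/
theorem WeaklySummable.exists_factorization {σ a b θ : ℝ} (hX : HasCotype σ X) (hσ : 2 ≤ σ)
    (ha : 1 ≤ a) (ha_two : σ = 2 → a ≤ 2) (ha_gt : 2 < σ → a < Real.conjExponent σ)
    (hθ0 : 0 < θ) (hθ1 : θ < 1) (hb : 1 / b = (1 - θ) + θ / a) {x : ℕ → X}
    (hx : WeaklySummable 𝕜 (ENNReal.ofReal b) x) :
    ∃ (l : ℕ → ℝ) (w : ℕ → X), (∀ i, 0 ≤ l i) ∧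
      (∀ i, x i = ((l i ^ (1 - θ) : ℝ) : 𝕜) • w i) ∧
      WeaklySummable 𝕜 (ENNReal.ofReal a) w ∧ Summable fun i => (l i * ‖w i‖) ^ σ := by
  have hσ0 : 0 < σ := by linarith
  -- For `a = 1` the conjugate exponent would be infinite, but then `b = 1` as well and `λ = 1`
  -- works: sums with coefficients in the unit ball are bounded, so cotype applies to `x` itself.
  rcases ha.eq_or_lt with rfl | ha1
  · have hb1 : b = 1 := by
      have : 1 / b = 1 := by rw [hb]; ring
      simpa using this
    subst hb1
    refine ⟨fun _ => 1, x, fun _ => zero_le_one, fun i => by simp, hx, ?_⟩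
    simp only [one_mul]
    obtain ⟨M, hM, H⟩ := (weaklySummable_ofReal_iff one_pos x).1 hx
    refine hX.summable_norm_rpow (𝕜 := 𝕜) hσ0 hM fun F c hc => ?_
    obtain ⟨φ, hφ, h⟩ := exists_functional_sum_le F x c
    refine h.trans ((Finset.sum_le_sum fun i _ => ?_).trans (H φ hφ F))
    rw [Real.rpow_one]
    exact mul_le_of_le_one_left (norm_nonneg _) (hc i)
  set q := Real.conjExponent a with hq
  have haq : a.HolderConjugate q := Real.HolderConjugate.conjExponent ha1
  have hq0 := haq.symm.pos
  have hq1 := haq.symm.lt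
  set ρ := q / θ with hρ
  have hqρ : q < ρ := (lt_div_iff₀ hθ0).2 (mul_lt_of_lt_one_right hq0 hθ1)
  have hρ0 : 0 < ρ := hq0.trans hqρ
  have hbρ : ρ.HolderConjugate b := by
    refine Real.holderConjugate_iff.2 ⟨hq1.trans hqρ, ?_⟩
    have h1 := haq.inv_add_inv_eq_one
    rw [← one_div b, hb, hρ, inv_div, div_eq_mul_inv, div_eq_mul_inv]
    linear_combination θ * h1
  obtain ⟨M, hM, hxM⟩ := hx.norm_sum_smul_le hbρ
  obtain ⟨K, β, hK, hβ, hβ1, hβx⟩ : ∃ (K : ℝ) (β : ℕ → ℝ), 0 ≤ K ∧ (∀ i, 0 ≤ β i) ∧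
      (∀ F : Finset ℕ, ∑ i ∈ F, β i ^ ρ ≤ 1) ∧ ∀ (F : Finset ℕ) (c : ℕ → 𝕜),
        ‖∑ i ∈ F, c i • x i‖ ^ q ≤ K * ∑ i ∈ F, β i ^ (ρ - q) * ‖c i‖ ^ q := by
    have hconj : ∀ t : ℝ, 1 < t → a < t / (t - 1) → t < q := by
      intro t ht h
      rw [hq, Real.conjExponent, lt_div_iff₀ (by linarith)]
      rw [lt_div_iff₀ (by linarith)] at h
      linarith
    -- Dyadic summation needs `σ < q` strictly. The hypotheses on `a` give this except when `σ = a =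
    -- 2`, where `q = 2` too and `2`-concavity takes over.
    by_cases hcase : σ = 2 ∧ a = 2
    · obtain ⟨rfl, rfl⟩ := hcase
      have hq2 : q = 2 := by rw [hq, Real.conjExponent]; norm_num
      rw [hq2] at hqρ ⊢
      obtain ⟨S₀, hS₀, HS⟩ := hX.two_concave hqρ.le hM x hxM
      exact exists_weight_of_two_concave x hqρ hS₀ HS
    · have hσq : σ < q := by
        refine hconj σ (by linarith) ?_
        rcases hσ.eq_or_lt with h2 | h2
        · rw [← h2]
          have := (ha_two h2.symm).lt_of_ne fun h => hcase ⟨h2.symm, h⟩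
          norm_num
          exact this
        · exact ha_gt h2
      obtain ⟨S₀, hS₀, HS⟩ := hX.one_concave hσ0 hρ0 hM x hxM
      exact exists_weight_of_one_concave x (by linarith) hσq hqρ hS₀ HS
  have hx0 : ∀ i, β i = 0 → x i = 0 := by
    intro i hi
    have h := hβx {i} fun _ => 1
    rw [Finset.sum_singleton, Finset.sum_singleton, hi, Real.zero_rpow (by linarith), zero_mul,
      mul_zero, one_smul] at h
    by_contra hne
    exact (Real.rpow_pos_of_pos (norm_pos_iff.2 hne) q).not_ge h
  -- Since `ρ = q / θ`, this exponent gives both `l ^ ((1 - θ) * q) = β ^ (ρ - q)`, cancelling the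
  -- weight in the estimate for `w`, and `l ^ q = β ^ ρ`, making `l` a unit-ball element of `ℓ_q`.
  set l : ℕ → ℝ := fun i => β i ^ (1 / θ) with hl
  have hl0 : ∀ i, 0 ≤ l i := fun i => Real.rpow_nonneg (hβ i) _
  set w : ℕ → X := fun i => (((l i ^ (1 - θ))⁻¹ : ℝ) : 𝕜) • x i with hw
  have hwK : ∀ (F : Finset ℕ) (c : ℕ → 𝕜),
      ‖∑ i ∈ F, c i • w i‖ ^ q ≤ K * ∑ i ∈ F, ‖c i‖ ^ q := by
    intro F c
    have h := hβx F fun i => c i * (((l i ^ (1 - θ))⁻¹ : ℝ) : 𝕜)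
    simp only [mul_smul] at h
    refine h.trans (mul_le_mul_of_nonneg_left (Finset.sum_le_sum fun i _ => ?_) hK)
    rw [norm_mul, RCLike.norm_ofReal,
      abs_of_nonneg (inv_nonneg.2 (Real.rpow_nonneg (hl0 i) _)),
      Real.mul_rpow (norm_nonneg _) (inv_nonneg.2 (Real.rpow_nonneg (hl0 i) _)), mul_left_comm]
    refine mul_le_of_le_one_right (by positivity) ?_
    rcases (hβ i).eq_or_lt with h0 | hpos
    · rw [← h0, Real.zero_rpow (by linarith), zero_mul]; exact zero_le_one
    · refine le_of_eq ?_
      simp only [hl]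
      rw [← Real.rpow_mul (hβ i), ← Real.rpow_neg (hβ i), ← Real.rpow_mul (hβ i),
        ← Real.rpow_add hpos, hρ]
      have : q / θ - q + -(1 / θ * (1 - θ)) * q = 0 := by field_simp; ring
      rw [this, Real.rpow_zero]
  refine ⟨l, w, hl0, fun i => ?_, weaklySummable_of_norm_sum_smul_le haq hK hwK, ?_⟩
  · rcases (hβ i).eq_or_lt with h0 | hpos
    · simp only [hw, hx0 i h0.symm, smul_zero]
    · have hne : l i ^ (1 - θ) ≠ 0 :=
        (Real.rpow_pos_of_pos (Real.rpow_pos_of_pos hpos _) _).ne'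
      simp only [hw]
      rw [smul_smul, ← RCLike.ofReal_mul, mul_inv_cancel₀ hne, RCLike.ofReal_one, one_smul]
  · have h := hX.summable_norm_rpow (𝕜 := 𝕜) (y := fun i => ((l i : ℝ) : 𝕜) • w i) hσ0
      (by positivity : 0 ≤ K ^ (1 / q)) fun F c hc => ?_
    · simpa only [norm_smul, RCLike.norm_ofReal, abs_of_nonneg (hl0 _)] using h
    · simp only [smul_smul]
      -- As `∑ l ^ q ≤ 1`, the operator on `ℓ_q` defined by `w` bounds all sums `∑ c i * l i • w i`
      -- with `‖c i‖ ≤ 1`; cotype then makes `l i * ‖w i‖` `σ`-summable.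
      have h1 : ‖∑ i ∈ F, (c i * ((l i : ℝ) : 𝕜)) • w i‖ ^ q ≤ K := by
        refine (hwK F _).trans (mul_le_of_le_one_right hK ?_)
        refine (Finset.sum_le_sum fun i _ => ?_).trans (hβ1 F)
        have e : β i ^ ρ = l i ^ q := by
          simp only [hl]
          rw [← Real.rpow_mul (hβ i), hρ]; congr 1; ring
        rw [e, norm_mul, RCLike.norm_ofReal, abs_of_nonneg (hl0 i)]
        exact Real.rpow_le_rpow (mul_nonneg (norm_nonneg _) (hl0 i))
          (mul_le_of_le_one_left (hl0 i) (hc i)) hq0.le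
      calc _ = (‖∑ i ∈ F, (c i * ((l i : ℝ) : 𝕜)) • w i‖ ^ q) ^ (1 / q) := by
            rw [← Real.rpow_mul (norm_nonneg _), mul_one_div_cancel hq0.ne', Real.rpow_one]
        _ ≤ _ := Real.rpow_le_rpow (by positivity) h1 (by positivity)

end WeakSummability

/-! ### Hölder and interpolation for scalar sequences. -/

section Summation

lemma summable_rpow_of_le {g : ℕ → ℝ} (hg : ∀ i, 0 ≤ g i) {α s : ℝ} (hα : 0 < α) (hαs : α ≤ s)
    (h : Summable fun i => g i ^ α) : Summable fun i => g i ^ s := by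
  refine Summable.of_norm_bounded_eventually h ?_
  filter_upwards [h.tendsto_cofinite_zero.eventually_le_const one_pos] with i hi
  rw [Real.norm_of_nonneg (Real.rpow_nonneg (hg i) _)]
  have h1 : g i ≤ 1 := by
    by_contra! hlt
    exact (Real.one_lt_rpow hlt hα).not_ge hi
  rcases (hg i).eq_or_lt with h0 | hpos
  · rw [← h0, Real.zero_rpow hα.ne', Real.zero_rpow (by linarith)]
  · exact Real.rpow_le_rpow_of_exponent_ge hpos h1 hαs

/-- Hölder's inequality: a product of `ℓ_{σⱼ}` sequences is in `ℓ_s` if `1/s ≤ ∑ 1/σⱼ`. -/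
lemma summable_prod_rpow {k : ℕ} {σ : Fin k → ℝ} (hσ : ∀ j, 0 < σ j) {s : ℝ} (hs : 0 < s)
    (hsσ : 1 / s ≤ ∑ j, 1 / σ j) {f : Fin k → ℕ → ℝ} (hf : ∀ j i, 0 ≤ f j i)
    (h : ∀ j, Summable fun i => f j i ^ σ j) : Summable fun i => (∏ j, f j i) ^ s := by
  set τ := ∑ j, 1 / σ j with hτ
  have hτ0 : 0 < τ := (one_div_pos.2 hs).trans_le hsσ
  refine summable_rpow_of_le (fun i => Finset.prod_nonneg fun j _ => hf j i) (one_div_pos.2 hτ0)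
    ((one_div_le hs hτ0).1 hsσ) ?_
  refine Summable.of_nonneg_of_le (fun i => Real.rpow_nonneg
    (Finset.prod_nonneg fun j _ => hf j i) _) (fun i => ?_)
    (summable_sum fun j (_ : j ∈ Finset.univ) => (h j).mul_left (1 / σ j / τ))
  -- Hölder at the exact exponent `1 / τ` is weighted AM–GM with weights `1 / (σ j * τ)`, which sum
  -- to one.
  have hg := Real.geom_mean_le_arith_mean_weighted Finset.univ (fun j => 1 / σ j / τ)
    (fun j => f j i ^ σ j)
    (fun j _ => div_nonneg (one_div_nonneg.2 (hσ j).le) hτ0.le)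
    (by rw [← Finset.sum_div, ← hτ, div_self hτ0.ne'])
    (fun j _ => Real.rpow_nonneg (hf j i) _)
  refine le_trans (le_of_eq ?_) hg
  rw [← Real.finsetProd_rpow _ _ fun j _ => hf j i]
  refine Finset.prod_congr rfl fun j _ => ?_
  rw [← Real.rpow_mul (hf j i)]
  congr 1
  have := (hσ j).ne'
  field_simp

lemma Summable.exists_base_le {g : ℕ → ℝ} (hg : ∀ i, 0 ≤ g i) {s : ℝ} (hs : 0 < s)
    (h : Summable fun i => g i ^ s) : ∃ M : ℝ, ∀ i, g i ≤ M := by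
  refine ⟨(∑' i, g i ^ s) ^ (1 / s), fun i => ?_⟩
  calc g i = (g i ^ s) ^ (1 / s) := by
        rw [← Real.rpow_mul (hg i), mul_one_div_cancel hs.ne', Real.rpow_one]
    _ ≤ _ := Real.rpow_le_rpow (Real.rpow_nonneg (hg i) _)
        (h.le_tsum i fun j _ => Real.rpow_nonneg (hg j) _) (by positivity)

/-- Pointwise geometric interpolation between `ℓ_s` and `ℓ_p`. -/
lemma memℓp_of_norm_le_interpolation {Y : Type*} [NormedAddCommGroup Y] {s θ : ℝ} (hs : 0 < s)
    (hθ0 : 0 < θ) (hθ1 : θ < 1) {p r : ℝ≥0∞} (hp : 0 < p)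
    (hr : r⁻¹ = ENNReal.ofReal ((1 - θ) / s) + ENNReal.ofReal θ * p⁻¹)
    {E : ℕ → ℝ} (hE : ∀ i, 0 ≤ E i) (hEs : Summable fun i => E i ^ s)
    {D z : ℕ → Y} (hD : Memℓp (E := fun _ => Y) D p)
    (hz : ∀ i, ‖z i‖ ≤ E i ^ (1 - θ) * ‖D i‖ ^ θ) : Memℓp (E := fun _ => Y) z r := by
  have hpinv : p⁻¹ ≠ ∞ := ENNReal.inv_ne_top.2 hp.ne'
  have hu0 : 0 < (1 - θ) / s := div_pos (by linarith) hs
  have hRinv : r.toReal⁻¹ = (1 - θ) / s + θ * p.toReal⁻¹ := by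
    rw [← ENNReal.toReal_inv, hr, ENNReal.toReal_add ENNReal.ofReal_ne_top
      (ENNReal.mul_ne_top ENNReal.ofReal_ne_top hpinv), ENNReal.toReal_mul, ENNReal.toReal_inv,
      ENNReal.toReal_ofReal hu0.le, ENNReal.toReal_ofReal hθ0.le]
  have hPinv0 : 0 ≤ p.toReal⁻¹ := inv_nonneg.2 ENNReal.toReal_nonneg
  set R := r.toReal with hR
  have hR0 : 0 < R := inv_pos.1 (by rw [hRinv]; positivity)
  refine (memℓp_gen_iff hR0).2 ?_
  have hz' : ∀ i, ‖z i‖ ^ R ≤ (E i ^ s) ^ ((1 - θ) / s * R) * ‖D i‖ ^ (θ * R) := by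
    intro i
    refine (Real.rpow_le_rpow (norm_nonneg _) (hz i) hR0.le).trans_eq ?_
    rw [Real.mul_rpow (Real.rpow_nonneg (hE i) _) (by positivity), ← Real.rpow_mul (hE i),
      ← Real.rpow_mul (hE i), ← Real.rpow_mul (norm_nonneg _)]
    congr 2
    field_simp
  by_cases hptop : p = ∞
  · rw [hptop, ENNReal.toReal_top, inv_zero, mul_zero, add_zero] at hRinv
    rw [hptop, memℓp_infty_iff] at hD
    obtain ⟨M, hM⟩ := hD
    have hDM : ∀ i, ‖D i‖ ≤ M := fun i => hM ⟨i, rfl⟩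
    refine Summable.of_nonneg_of_le (fun i => by positivity) (fun i => ?_)
      (hEs.mul_right (M ^ (θ * R)))
    refine (hz' i).trans ?_
    rw [← hRinv, inv_mul_cancel₀ hR0.ne', Real.rpow_one]
    exact mul_le_mul_of_nonneg_left (Real.rpow_le_rpow (norm_nonneg _) (hDM i) (by positivity))
      (Real.rpow_nonneg (hE i) _)
  · have hP0 : 0 < p.toReal := ENNReal.toReal_pos hp.ne' hptop
    have hDs := (memℓp_gen_iff hP0).1 hD
    refine Summable.of_nonneg_of_le (fun i => by positivity) (fun i => ?_)
      ((hEs.mul_left ((1 - θ) / s * R)).add (hDs.mul_left (θ * p.toReal⁻¹ * R)))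
    refine (hz' i).trans ?_
    have e : ‖D i‖ ^ (θ * R) = (‖D i‖ ^ p.toReal) ^ (θ * p.toReal⁻¹ * R) := by
      rw [← Real.rpow_mul (norm_nonneg _)]; congr 1; field_simp
    rw [e]
    exact Real.geom_mean_le_arith_mean2_weighted (by positivity) (by positivity)
      (Real.rpow_nonneg (hE i) _) (by positivity)
      (by rw [← add_mul, ← hRinv, inv_mul_cancel₀ hR0.ne'])

end Summation

/-! ### Admissibility of the interpolated exponents. -/

section Exponents

lemma mixedExponents_castAdd {k l : ℕ} (a : Fin k → ℝ) (q : ℝ≥0∞) (j : Fin k) :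
    mixedExponents (k + l) a q (Fin.castAdd l j) = ENNReal.ofReal (a j) := by
  simp [mixedExponents]

lemma mixedExponents_natAdd {k l : ℕ} (a : Fin k → ℝ) (q : ℝ≥0∞) (j : Fin l) :
    mixedExponents (k + l) a q (Fin.natAdd k j) = q := by
  simp [mixedExponents]

/-- The interpolated exponents remain admissible. -/
lemma interpolated_exponent_le {k l : ℕ} {s θ : ℝ} {σ a b : Fin k → ℝ} (hσ : ∀ j, 1 ≤ σ j)
    (hsσ : 1 / s ≤ ∑ j, 1 / σ j) (ha : ∀ j, 0 < a j) (hθ0 : 0 < θ) (hθ1 : θ < 1)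
    (hb : ∀ j, 1 / b j = (1 - θ) / 1 + θ / a j) {p q r : ℝ≥0∞}
    (hr : r⁻¹ = ENNReal.ofReal ((1 - θ) / s) + ENNReal.ofReal θ * p⁻¹)
    (hp : p⁻¹ ≤ ∑ j, (mixedExponents (k + l) a q j)⁻¹) :
    r⁻¹ ≤ ∑ j, (mixedExponents (k + l) b q j)⁻¹ := by
  have hb0 : ∀ j, 0 < b j := fun j => by
    have : 0 < θ / a j := div_pos hθ0 (ha j)
    exact one_div_pos.1 (by rw [hb, div_one]; linarith)
  rw [Fin.sum_univ_add] at hp ⊢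
  simp only [mixedExponents_castAdd, mixedExponents_natAdd] at hp ⊢
  have hterm : ∀ j, (ENNReal.ofReal (b j))⁻¹ =
      ENNReal.ofReal (1 - θ) + ENNReal.ofReal θ * (ENNReal.ofReal (a j))⁻¹ := by
    intro j
    rw [← ENNReal.ofReal_inv_of_pos (hb0 j), ← ENNReal.ofReal_inv_of_pos (ha j),
      ← ENNReal.ofReal_mul hθ0.le, ← ENNReal.ofReal_add (by linarith)
        (mul_nonneg hθ0.le (inv_nonneg.2 (ha j).le)), ← one_div, hb, div_one, div_eq_mul_inv]
  -- The part `(1 - θ) / s` is covered by the first `k` exponents because each `1 / σ j ≤ 1`. In the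
  -- remaining part, the `q`-terms only gain from dropping the factor `θ ≤ 1`.
  have hfirst : ENNReal.ofReal ((1 - θ) / s) ≤ ∑ _j : Fin k, ENNReal.ofReal (1 - θ) := by
    rw [← ENNReal.ofReal_sum_of_nonneg fun _ _ => by linarith]
    refine ENNReal.ofReal_le_ofReal ?_
    calc (1 - θ) / s = (1 - θ) * (1 / s) := by ring
      _ ≤ (1 - θ) * ∑ j, 1 / σ j := mul_le_mul_of_nonneg_left hsσ (by linarith)
      _ = ∑ j, (1 - θ) * (1 / σ j) := Finset.mul_sum _ _ _
      _ ≤ ∑ _j : Fin k, (1 - θ) := Finset.sum_le_sum fun j _ =>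
          mul_le_of_le_one_right (by linarith) ((div_le_one (by linarith [hσ j])).2 (hσ j))
  have hθle : ENNReal.ofReal θ ≤ 1 := ENNReal.ofReal_le_one.2 hθ1.le
  simp only [hterm, Finset.sum_add_distrib, ← Finset.mul_sum]
  rw [hr, add_assoc]
  refine add_le_add hfirst ((mul_le_mul_right hp _).trans ?_)
  rw [mul_add]
  exact add_le_add_right (mul_le_of_le_one_left zero_le hθle) _

end Exponents

/-! ### The inclusion theorem. -/

theorem theorem2p3 {𝕜 : Type*} [RCLike 𝕜] (n k : ℕ) (hk : 1 ≤ k) (hkn : k ≤ n)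
    (X : Fin n → Type*) (Y : Type*)
    [∀ j, NormedAddCommGroup (X j)] [∀ j, NormedSpace 𝕜 (X j)] [∀ j, CompleteSpace (X j)]
    [NormedAddCommGroup Y] [NormedSpace 𝕜 Y] [CompleteSpace Y]
    (s : ℝ) (hs : 1 ≤ s)
    (σ : Fin k → ℝ) (hσ : ∀ j, 2 ≤ σ j)
    (hcot : ∀ j, HasCotype (σ j) (X (Fin.castLE hkn j)))
    (hsσ : 1 / s ≤ ∑ j, 1 / σ j)
    (p q : ℝ≥0∞) (hp : 0 < p) (hq : 1 ≤ q)
    (a : Fin k → ℝ) (ha : ∀ j, 1 ≤ a j)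
    (ha_two : ∀ j, σ j = 2 → a j ≤ 2)
    (ha_gt : ∀ j, 2 < σ j → a j < Real.conjExponent (σ j))
    (θ : ℝ) (hθ : θ ∈ Set.Ioo (0 : ℝ) 1)
    (r : ℝ≥0∞) (hr : r⁻¹ = ENNReal.ofReal ((1 - θ) / s) + ENNReal.ofReal θ * p⁻¹)
    (b : Fin k → ℝ) (hb : ∀ j, 1 / b j = (1 - θ) / 1 + θ / a j) :
    AbsSumming 𝕜 X Y p (mixedExponents n a q) ⊆
      AbsSumming 𝕜 X Y r (mixedExponents n b q) := by
  obtain ⟨hθ0, hθ1⟩ := hθ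
  obtain ⟨d, rfl⟩ := Nat.exists_eq_add_of_le hkn
  rintro T ⟨hadm, hT⟩
  refine ⟨interpolated_exponent_le (fun j => by linarith [hσ j]) hsσ
    (fun j => by linarith [ha j]) hθ0 hθ1 hb hr hadm, fun x hx => ?_⟩
  -- A uniform format for all coordinates: the last `d` keep their sequence with `l = 1` and are
  -- merely bounded, while summability is asserted only for the first `k`.
  have hfact : ∀ j : Fin (k + d), ∃ (l : ℕ → ℝ) (w : ℕ → X j), (∀ i, 0 ≤ l i) ∧
      (∀ i, x j i = ((l i ^ (1 - θ) : ℝ) : 𝕜) • w i) ∧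
      WeaklySummable 𝕜 (mixedExponents (k + d) a q j) w ∧
      (∃ M, ∀ i, l i * ‖w i‖ ≤ M) ∧
      ∀ j' : Fin k, j = Fin.castAdd d j' → Summable fun i => (l i * ‖w i‖) ^ σ j' := by
    refine Fin.addCases (fun j => ?_) (fun j => ?_)
    · have h := hx (Fin.castAdd d j)
      rw [mixedExponents_castAdd] at h ⊢
      obtain ⟨l, w, hl, hxw, hw, hlw⟩ := h.exists_factorization (hcot j) (hσ j) (ha j) (ha_two j)
        (ha_gt j) hθ0 hθ1 (by rw [hb, div_one])
      refine ⟨l, w, hl, hxw, hw, hlw.exists_base_le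
        (fun i => mul_nonneg (hl i) (norm_nonneg _)) (by linarith [hσ j]), fun j' hj' => ?_⟩
      rwa [← Fin.castAdd_injective k d hj']
    · have h := hx (Fin.natAdd k j)
      rw [mixedExponents_natAdd] at h ⊢
      refine ⟨fun _ => 1, x (Fin.natAdd k j), fun _ => zero_le_one, fun i => by simp, h, ?_,
        fun j' hj' => ?_⟩
      · simpa only [one_mul] using h.exists_norm_le (zero_lt_one.trans_le hq)
      · have := congrArg Fin.val hj'
        simp only [Fin.val_natAdd, Fin.val_castAdd] at this
        omega
  choose l w hl hxw hw hbd hsum using hfact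
  choose M hM using hbd
  have hlw : ∀ j i, 0 ≤ l j i * ‖w j i‖ := fun j i => mul_nonneg (hl j i) (norm_nonneg _)
  set E : ℕ → ℝ := fun i => ∏ j : Fin k, l (Fin.castAdd d j) i * ‖w (Fin.castAdd d j) i‖ with hE
  have hE0 : ∀ i, 0 ≤ E i := fun i => Finset.prod_nonneg fun j _ => hlw _ i
  have hEs : Summable fun i => E i ^ s :=
    summable_prod_rpow (fun j => by linarith [hσ j]) (by linarith) hsσ (fun j i => hlw _ i)
      fun j => hsum _ j rfl
  have hM0 : ∀ j, 0 ≤ M j := fun j => (hlw j 0).trans (hM j 0)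
  set B : ℝ := ‖T‖ * ∏ j : Fin d, M (Fin.natAdd k j) with hB
  have hB0 : 0 ≤ B := mul_nonneg (norm_nonneg _) (Finset.prod_nonneg fun j _ => hM0 _)
  have hBE : ∀ i, (∏ j, l j i) * ‖T fun j => w j i‖ ≤ B * E i := by
    intro i
    calc (∏ j, l j i) * ‖T fun j => w j i‖
        ≤ (∏ j, l j i) * (‖T‖ * ∏ j, ‖w j i‖) :=
          mul_le_mul_of_nonneg_left (T.le_opNorm _) (Finset.prod_nonneg fun j _ => hl j i)
      _ = ‖T‖ * ∏ j, l j i * ‖w j i‖ := by rw [Finset.prod_mul_distrib]; ring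
      _ = ‖T‖ * (E i * ∏ j : Fin d, l (Fin.natAdd k j) i * ‖w (Fin.natAdd k j) i‖) := by
          rw [Fin.prod_univ_add]
      _ ≤ ‖T‖ * (E i * ∏ j : Fin d, M (Fin.natAdd k j)) :=
          mul_le_mul_of_nonneg_left (mul_le_mul_of_nonneg_left
            (Finset.prod_le_prod (fun j _ => hlw _ i) fun j _ => hM _ i) (hE0 i)) (norm_nonneg _)
      _ = B * E i := by rw [hB]; ring
  refine memℓp_of_norm_le_interpolation (E := fun i => B * E i) (by linarith) hθ0 hθ1 hp hr
    (fun i => mul_nonneg hB0 (hE0 i)) ?_ (hT w hw) fun i => ?_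
  · simpa only [Real.mul_rpow hB0 (hE0 _)] using hEs.mul_left (B ^ s)
  · have hl' : 0 ≤ ∏ j, l j i := Finset.prod_nonneg fun j _ => hl j i
    have e : ‖T fun j => x j i‖ = (∏ j, l j i) ^ (1 - θ) * ‖T fun j => w j i‖ := by
      simp only [hxw]
      rw [T.map_smul_univ, norm_smul, norm_prod, ← Real.finsetProd_rpow _ _ fun j _ => hl j i]
      congr 1
      refine Finset.prod_congr rfl fun j _ => ?_
      rw [RCLike.norm_ofReal, abs_of_nonneg (Real.rpow_nonneg (hl j i) _)]
    -- Splitting `‖T w‖` lets its `(1 - θ)`-th power join the product of the `l`'s, to which `hBE`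
    -- applies, and leaves the `θ`-th power to be controlled in `ℓ_p`.
    have e2 : ‖T fun j => w j i‖ = ‖T fun j => w j i‖ ^ (1 - θ) * ‖T fun j => w j i‖ ^ θ := by
      rw [← Real.rpow_add_of_nonneg (norm_nonneg _) (by linarith) hθ0.le, sub_add_cancel,
        Real.rpow_one]
    calc ‖T fun j => x j i‖
        = ((∏ j, l j i) * ‖T fun j => w j i‖) ^ (1 - θ) * ‖T fun j => w j i‖ ^ θ := by
          rw [e, Real.mul_rpow hl' (norm_nonneg _), mul_assoc, ← e2]
      _ ≤ (B * E i) ^ (1 - θ) * ‖T fun j => w j i‖ ^ θ :=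
          mul_le_mul_of_nonneg_right (Real.rpow_le_rpow (mul_nonneg hl' (norm_nonneg _)) (hBE i)
            (by linarith)) (Real.rpow_nonneg (norm_nonneg _) _)
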